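/- Let $K$ be an infinite field, let $n \ge 2$ and $m \ge 0$ be integers, and let $V = \mathrm{Mat}_{n,n}(K)^m$ be the space of $m$-tuples $X = (X_1,\dots,X_m)$ of $n\times n$ matrices over $K$. The group $\mathrm{SL}_n(K)\times \mathrm{SL}_n(K)$ acts on $V$ by $(A,B)\cdot(X_1,\dots,X_m) = (AX_1B^{-1},\dots,AX_mB^{-1})$. Let $R(n,m) = K[V]^{\mathrm{SL}_n\times \mathrm{SL}_n}$ be the graded ring of invariant polynomial functions on $V$, and let the null cone $\mathcal N(n,m)\subseteq V$ be the set of common zeros of all homogeneous invariants of positive degree. For an integer $d \ge 1$ and $T = (T_1,\dots,T_m)\in \mathrm{Mat}_{d,d}(K)^m$ put $$f_T(X) = \det(X_1\otimes T_1+\cdots+X_m\otimes T_m),$$ where $\otimes$ is the Kronecker product. Let $\delta(n,m)$ be the smallest positive integer $k$ such that for every $X\in V\setminus\mathcal N(n,m)$ there are an integer $d$ with $1\le d\le k$ and $T\in \mathrm{Mat}_{d,d}(K)^m$ with $f_T(X)\ne 0$. Let $\gamma(n,m)$ be the smallest positive integer $k$ such that $\mathcal N(n,m)$ is the set of common zeros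 of the homogeneous invariants of positive degree at most $k$. Then for every $X\in V\setminus \mathcal N(n,m)$ and every integer $d\ge n-1$ there is $T\in \mathrm{Mat}_{d,d}(K)^m$ such that $f_T(X)\neq 0$. In particular, $\delta(n,m)$ and $\gamma(n,m)$ exist, and $\delta(n,m)\le n-1$ and $\gamma(n,m)\le n(n-1)$. -/

import Mathlib

namespace LeftRight

/-- The space of `m`-tuples of `n × n` matrices over `K`. -/
abbrev MatTuple (K : Type*) (n m : ℕ) : Type _ :=
  Fin m → Matrix (Fin n) (Fin n) K

/-- The left-right action of `SL_n × SL_n`: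
`(A, B) · (X_1, …, X_m) = (A X_1 B⁻¹, …, A X_m B⁻¹)`. -/
def act {K : Type*} [Field K] {n m : ℕ}
    (g : Matrix.SpecialLinearGroup (Fin n) K × Matrix.SpecialLinearGroup (Fin n) K)
    (X : MatTuple K n m) : MatTuple K n m :=
  fun i => (g.1 : Matrix (Fin n) (Fin n) K) * X i *
    ((g.2⁻¹ : Matrix.SpecialLinearGroup (Fin n) K) : Matrix (Fin n) (Fin n) K)

/-- The coordinate ring of the space of `m`-tuples of `n × n` matrices: the variable
`(i, a, b)` is the `(a, b)` entry of the `i`-th matrix. -/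
abbrev CoordRing (K : Type*) [Field K] (n m : ℕ) : Type _ :=
  MvPolynomial (Fin m × Fin n × Fin n) K

/-- The value of a polynomial at a tuple of matrices. -/
def evalAt {K : Type*} [Field K] {n m : ℕ} (X : MatTuple K n m) :
    CoordRing K n m →ₐ[K] K :=
  MvPolynomial.aeval fun p => X p.1 p.2.1 p.2.2

/-- The invariant ring `R(n, m)`: the polynomials `f` with `f (g · X) = f X` for all `g` and `X`.
(Over an infinite field a polynomial is determined by its values.) -/
def invariantRing (K : Type*) [Field K] (n m : ℕ) : Subalgebra K (CoordRing K n m) where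
  carrier := {f | ∀ g (X : MatTuple K n m), evalAt (act g X) f = evalAt X f}
  mul_mem' := by
    intro f₁ f₂ h₁ h₂ g X
    rw [map_mul, map_mul, h₁ g X, h₂ g X]
  add_mem' := by
    intro f₁ f₂ h₁ h₂ g X
    rw [map_add, map_add, h₁ g X, h₂ g X]
  algebraMap_mem' := by
    intro c g X
    rw [AlgHom.commutes, AlgHom.commutes]

/-- The null cone `N(n, m)`: the common zeros of all homogeneous invariants of positive degree. -/
def nullCone (K : Type*) [Field K] (n m : ℕ) : Set (MatTuple K n m) :=
  {X | ∀ e : ℕ, 1 ≤ e → ∀ f ∈ invariantRing K n m, f.IsHomogeneous e → evalAt X f = 0}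

/-- The common zeros of all homogeneous invariants of positive degree at most `k`. -/
def zerosUpTo (K : Type*) [Field K] (n m k : ℕ) : Set (MatTuple K n m) :=
  {X | ∀ e : ℕ, 1 ≤ e → e ≤ k →
    ∀ f ∈ invariantRing K n m, f.IsHomogeneous e → evalAt X f = 0}

/-- The positive integers `k` such that the homogeneous invariants of positive degree at most `k`
define the null cone. -/
def gammaSet (K : Type*) [Field K] (n m : ℕ) : Set ℕ :=
  {k | 1 ≤ k ∧ zerosUpTo K n m k = nullCone K n m}

/-- `γ(n, m)`, the smallest element of `gammaSet K n m`. -/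
noncomputable def gamma (K : Type*) [Field K] (n m : ℕ) : ℕ :=
  sInf (gammaSet K n m)

open scoped Kronecker in
/-- `f_T(X) = det (X_1 ⊗ T_1 + ⋯ + X_m ⊗ T_m)` for an `m`-tuple `T` of `d × d` matrices. -/
def fT {K : Type*} [Field K] {n m d : ℕ} (T : MatTuple K d m) (X : MatTuple K n m) : K :=
  (∑ i, X i ⊗ₖ T i).det

/-- The positive integers `k` such that every `X` outside the null cone satisfies `f_T(X) ≠ 0` for
some `m`-tuple `T` of `d × d` matrices with `1 ≤ d ≤ k`. -/
def deltaSet (K : Type*) [Field K] (n m : ℕ) : Set ℕ :=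
  {k | 1 ≤ k ∧ ∀ X : MatTuple K n m, X ∉ nullCone K n m →
    ∃ d : ℕ, 1 ≤ d ∧ d ≤ k ∧ ∃ T : MatTuple K d m, fT T X ≠ 0}

/-- `δ(n, m)`, the smallest element of `deltaSet K n m`. -/
noncomputable def delta (K : Type*) [Field K] (n m : ℕ) : ℕ :=
  sInf (deltaSet K n m)

end LeftRight

namespace LeftRight

/-! ### Minors and genericity of the rank -/

/-! Call a subspace shrunk if all the `X i` map it into one common space of smaller dimension. A
shrunk subspace puts `X` in the null cone: a one-parameter subgroup adapted to it drives `X` to `0`,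
and a homogeneous invariant of positive degree is constant along the way
(`mem_nullCone_of_hasShrunkSubspace`). So it suffices to find, for `X` without shrunk subspace and
`d ≥ n - 1`, a tuple `T` of size `d` for which the blow-up `∑ X i ⊗ T i` is invertible.

Everything rests on the regularity lemma (`dvd_rank_blowup_of_max`): the maximal rank of a blow-up
of size `d` is a multiple of `d`. Over an extension field the `d × d` matrices are spanned by a
division algebra, block matrices with blocks in it have rank divisible by `d`, and genericity
carries this back to the infinite field `K`.

Some size works (`exists_blowup_rank_eq_of_not_hasShrunkSubspace`): let `q` be the largest quotient
of maximal rank by size. If `q < n`, block bidiagonal tuples cannot beat `q` either, and this forces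
the Wong sequence of an optimal blow-up to stay inside its range. The limit of the sequence is a
shrunk subspace.

The size can then be lowered from `e + 1` to `e` as long as `e ≥ n - 1`
(`exists_blowup_rank_eq_of_succ`). Delete the last block row of an invertible blow-up. A dimension
count shows that some block column can be deleted as well with rank above `(n - 1) * e` remaining,
and regularity rounds this up to `n * e`. The count reaches `e = n - 1` because one block column can
be kept of full rank `n`, which in turn uses that a tuple without shrunk subspace has a linear
combination of rank at least two.

Taking `d = n - 1` bounds `δ`, and `f_T`, an invariant of degree `n * d`, bounds `γ`. -/

theorem exists_linearIndependent_rows {K α β : Type*} [Field K] [Fintype α] [Fintype β]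
    (A : Matrix α β K) {r : ℕ} (hr : A.rank = r) :
    ∃ f : Fin r → α, LinearIndependent K (A.submatrix f id).row := by
  classical
  obtain ⟨κ, a, ha, hspan, hli⟩ := exists_linearIndependent' K A.row
  have : Fintype κ := Fintype.ofInjective a ha
  have hcard : Fintype.card κ = r := by
    rw [← hr, A.rank_eq_finrank_span_row, ← hspan, finrank_span_eq_card hli]
  let e : Fin r ≃ κ := (Fintype.equivFinOfCardEq hcard).symm
  exact ⟨a ∘ e, hli.comp e e.injective⟩

theorem exists_det_submatrix_ne_zero {K α β : Type*} [Field K] [Fintype α] [Fintype β]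
    (A : Matrix α β K) :
    ∃ (f : Fin A.rank → α) (g : Fin A.rank → β), (A.submatrix f g).det ≠ 0 := by
  obtain ⟨f, hf⟩ := exists_linearIndependent_rows A rfl
  have hr : (A.submatrix f id).transpose.rank = A.rank := by
    rw [Matrix.rank_transpose, hf.rank_matrix, Fintype.card_fin]
  obtain ⟨g, hg⟩ := exists_linearIndependent_rows (A.submatrix f id).transpose hr
  refine ⟨f, g, fun h => ?_⟩
  rw [Matrix.linearIndependent_rows_iff_isUnit, Matrix.isUnit_iff_isUnit_det,
    isUnit_iff_ne_zero] at hg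
  apply hg
  rw [← h, ← Matrix.det_transpose]
  rfl

theorem le_rank_of_det_submatrix_ne_zero {K α β : Type*} [Field K] [Fintype α] [Fintype β]
    (A : Matrix α β K) {r : ℕ} (f : Fin r → α) (g : Fin r → β)
    (h : (A.submatrix f g).det ≠ 0) : r ≤ A.rank := by
  simpa [Matrix.rank_of_det_ne_zero h] using A.rank_submatrix_le f g

theorem rank_map_ringHom {K L α β : Type*} [Field K] [Field L] [Fintype α] [Fintype β]
    (φ : K →+* L) (A : Matrix α β K) : (A.map φ).rank = A.rank := by
  apply le_antisymm
  · obtain ⟨f, g, h⟩ := exists_det_submatrix_ne_zero (A.map φ)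
    refine le_rank_of_det_submatrix_ne_zero A f g fun h0 => h ?_
    rw [Matrix.submatrix_map, ← RingHom.mapMatrix_apply, ← RingHom.map_det, h0, map_zero]
  · obtain ⟨f, g, h⟩ := exists_det_submatrix_ne_zero A
    refine le_rank_of_det_submatrix_ne_zero (A.map φ) f g ?_
    rw [Matrix.submatrix_map, ← RingHom.mapMatrix_apply, ← RingHom.map_det]
    exact (map_ne_zero φ).2 h

/-- The locus where a matrix of polynomials has at least its rank at a given point contains the
nonvanishing locus of a polynomial that is nonzero at that point. -/
theorem exists_polynomial_rank_le {L σ α β : Type*} [Field L] [Fintype α] [Fintype β]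
    (P : Matrix α β (MvPolynomial σ L)) (x : σ → L) :
    ∃ p : MvPolynomial σ L, MvPolynomial.eval x p ≠ 0 ∧ ∀ y, MvPolynomial.eval y p ≠ 0 →
      (P.map (MvPolynomial.eval x)).rank ≤ (P.map (MvPolynomial.eval y)).rank := by
  obtain ⟨f, g, h⟩ := exists_det_submatrix_ne_zero (P.map (MvPolynomial.eval x))
  have key : ∀ z : σ → L, MvPolynomial.eval z (P.submatrix f g).det =
      ((P.map (MvPolynomial.eval z)).submatrix f g).det := fun z => by
    rw [Matrix.submatrix_map, RingHom.map_det, RingHom.mapMatrix_apply]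
  refine ⟨(P.submatrix f g).det, by rwa [key], fun y hy => ?_⟩
  rw [key] at hy
  exact le_rank_of_det_submatrix_ne_zero _ f g hy

theorem exists_eval_ne_zero_of_infinite {L σ : Type*} [Field L] {S : Set L} (hS : S.Infinite)
    {p : MvPolynomial σ L} (hp : p ≠ 0) :
    ∃ y : σ → L, (∀ i, y i ∈ S) ∧ MvPolynomial.eval y p ≠ 0 := by
  by_contra! h
  refine hp (MvPolynomial.funext_set (fun _ => S) (fun _ => hS) fun y hy => ?_)
  rw [map_zero]
  exact h y fun i => hy i (Set.mem_univ i)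

/-- The rank of a matrix of polynomials at some point with coordinates in an infinite set is at
least its rank at any given point. -/
theorem exists_rank_le_of_infinite {L σ α β : Type*} [Field L] [Fintype α] [Fintype β]
    {S : Set L} (hS : S.Infinite) (P : Matrix α β (MvPolynomial σ L)) (x : σ → L) :
    ∃ y : σ → L, (∀ i, y i ∈ S) ∧
      (P.map (MvPolynomial.eval x)).rank ≤ (P.map (MvPolynomial.eval y)).rank := by
  obtain ⟨p, hp, h⟩ := exists_polynomial_rank_le P x
  obtain ⟨y, hy, hpy⟩ := exists_eval_ne_zero_of_infinite hS (p := p) (by rintro rfl; simp at hp)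
  exact ⟨y, hy, h y hpy⟩

end LeftRight

namespace LeftRight

/-! ### A cyclic division algebra of prescribed degree over an extension field -/

theorem sum_ne_zero_of_totalDegree_lt {K σ ι : Type*} [Field K] [Fintype ι]
    (f : ι → MvPolynomial σ K) (k : ι) (hk : f k ≠ 0)
    (h : ∀ j, j ≠ k → f j = 0 ∨ (f j).totalDegree < (f k).totalDegree) : ∑ j, f j ≠ 0 := by
  classical
  intro h0
  rw [← Finset.add_sum_erase _ _ (Finset.mem_univ k)] at h0
  rcases Nat.eq_zero_or_pos (f k).totalDegree with hd | hd
  · rw [Finset.sum_eq_zero fun j hj => ?_, add_zero] at h0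
    · exact hk h0
    · exact (h j (Finset.ne_of_mem_erase hj)).resolve_right (by omega)
  · have h1 : (∑ j ∈ Finset.univ.erase k, f j).totalDegree ≤ (f k).totalDegree - 1 := by
      refine MvPolynomial.totalDegree_finsetSum_le fun j hj => ?_
      rcases h j (Finset.ne_of_mem_erase hj) with h | h
      · simp [h]
      · omega
    rw [← neg_eq_of_add_eq_zero_right h0, MvPolynomial.totalDegree_neg] at h1
    omega

/-- The weights `1, …, 1, s` of the twisted cyclic permutation matrix. -/
def cyclicWeight {A : Type*} [One A] (e : ℕ) (s : A) (i : Fin (e + 1)) : A :=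
  if i = Fin.last e then s else 1

theorem fin_induction_add_one {e : ℕ} {Q : Fin (e + 1) → Prop} (h0 : Q 0)
    (h : ∀ t, Q t → Q (t + 1)) (t : Fin (e + 1)) : Q t := by
  induction t using Fin.induction with
  | zero => exact h0
  | succ j ih => exact Fin.coeSucc_eq_succ (a := j) ▸ h _ ih

/-- A valuation argument: some row of the product has exactly one term of largest degree, so nothing
cancels it. Degrees are refined to weights in units of `1 / (e + 1)`, as if `s` were the `(e +
1)`-st power of an element of fractional degree. -/
theorem cyclic_mulVec_ne_zero {K σ : Type*} [Field K] {e : ℕ}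
    (s : MvPolynomial σ K) (hs : s.totalDegree = 1)
    (τ : MvPolynomial σ K ≃ₐ[K] MvPolynomial σ K) (hτ : ∀ f, (τ f).totalDegree = f.totalDegree)
    (M : Matrix (Fin (e + 1)) (Fin (e + 1)) (MvPolynomial σ K))
    (hM : ∀ i k, M i k * cyclicWeight e s k = cyclicWeight e s i * τ (M (i + 1) (k + 1)))
    (hM0 : M ≠ 0) (v : Fin (e + 1) → MvPolynomial σ K) (hv : v ≠ 0) : M.mulVec v ≠ 0 := by
  classical
  have hs0 : s ≠ 0 := by rintro rfl; simp at hs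
  have hw : ∀ i, cyclicWeight e s i ≠ 0 := fun i => by
    unfold cyclicWeight; split_ifs <;> simp [hs0]
  -- `W` is constant along cyclic diagonals: crossing the index `e` changes the degree by `deg s =
  -- 1`, and the jump of the index by `e + 1` compensates. The nonzero entries of `v` have distinct
  -- `V`, being distinct modulo `e + 1`. Up to the row index, `W + V` is `e + 1` times the degree of
  -- a term of the product.
  let W : Fin (e + 1) → Fin (e + 1) → ℤ := fun i k =>
    (e + 1) * ((M i k).totalDegree : ℤ) + (k : ℕ) - (i : ℕ)
  let V : Fin (e + 1) → ℤ := fun k => (e + 1) * ((v k).totalDegree : ℤ) - (k : ℕ)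
  have hne : ∀ i k, M i k ≠ 0 ↔ M (i + 1) (k + 1) ≠ 0 := fun i k => by
    constructor
    · intro h h'
      have := hM i k
      rw [h', map_zero, mul_zero] at this
      exact mul_ne_zero h (hw k) this
    · intro h h'
      have := hM i k
      rw [h', zero_mul] at this
      exact mul_ne_zero (hw i) (by simpa using h) this.symm
  have hdeg : ∀ i : Fin (e + 1), (e + 1) * ((cyclicWeight e s i).totalDegree : ℤ) =
      (i : ℕ) + 1 - ((i + 1 : Fin (e + 1)) : ℕ) := fun i => by
    unfold cyclicWeight
    rw [Fin.val_add_one]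
    split_ifs with h
    · simp [hs, h]
    · simp
  have hW : ∀ i k, M i k ≠ 0 → W (i + 1) (k + 1) = W i k := fun i k h => by
    have h1 := congrArg MvPolynomial.totalDegree (hM i k)
    rw [MvPolynomial.totalDegree_mul_of_isDomain h (hw k),
      MvPolynomial.totalDegree_mul_of_isDomain (hw i) (by simpa using (hne i k).1 h), hτ] at h1
    have h2 := congrArg (fun n : ℕ => ((e + 1 : ℕ) : ℤ) * (n : ℤ)) h1
    push_cast at h2
    have h3 := hdeg i
    have h4 := hdeg k
    simp only [W]
    linarith
  have hshift : ∀ i k t, M i k ≠ 0 → M (i + t) (k + t) ≠ 0 ∧ W (i + t) (k + t) = W i k := by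
    intro i k t h
    induction t using fin_induction_add_one with
    | h0 => simpa using h
    | h t ih =>
      rw [← add_assoc, ← add_assoc]
      exact ⟨(hne _ _).1 ih.1, (hW _ _ ih.1).trans ih.2⟩
  obtain ⟨a, b, hab⟩ : ∃ a b, M a b ≠ 0 := by
    by_contra! h
    exact hM0 (Matrix.ext h)
  obtain ⟨c, hc⟩ : ∃ c, v c ≠ 0 := Function.ne_iff.1 hv
  obtain ⟨⟨i₁, k₁⟩, hik, hmax⟩ := Finset.exists_max_image
    (Finset.univ.filter fun q : Fin (e + 1) × Fin (e + 1) => M q.1 q.2 ≠ 0) (fun q => W q.1 q.2)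
    ⟨(a, b), by simpa using hab⟩
  obtain ⟨k₀, hk₀, hmaxv⟩ := Finset.exists_max_image
    (Finset.univ.filter fun q : Fin (e + 1) => v q ≠ 0) V ⟨c, by simpa using hc⟩
  simp only [Finset.mem_filter, Finset.mem_univ, true_and, Prod.forall] at hik hmax hk₀ hmaxv
  -- The maximum of `W` is moved along its diagonal into the column `k₀` where `V` is maximal; row
  -- `i₀` then has its dominant term there.
  obtain ⟨h1, h2⟩ := hshift i₁ k₁ (k₀ - k₁) hik
  rw [add_sub_cancel] at h1 h2
  set i₀ := i₁ + (k₀ - k₁)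
  intro h
  refine sum_ne_zero_of_totalDegree_lt (fun k => M i₀ k * v k) k₀ (mul_ne_zero h1 hk₀)
    (fun k hk => ?_) (congrFun h i₀)
  by_cases hz : M i₀ k = 0
  · left; simp [hz]
  by_cases hz' : v k = 0
  · left; simp [hz']
  right
  rw [MvPolynomial.totalDegree_mul_of_isDomain hz hz',
    MvPolynomial.totalDegree_mul_of_isDomain h1 hk₀]
  have h3 := hmax i₀ k hz
  rw [← h2] at h3
  have h4 : V k < V k₀ := by
    refine lt_of_le_of_ne (hmaxv k hz') fun h => hk ?_
    have h5 : ((e + 1 : ℕ) : ℤ) ∣ (k : ℕ) - (k₀ : ℕ) :=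
      ⟨(v k).totalDegree - (v k₀).totalDegree, by simp only [V] at h; push_cast; linarith⟩
    have h6 := Int.eq_zero_of_abs_lt_dvd h5 (by
      have := k.isLt; have := k₀.isLt
      rw [abs_lt]; constructor <;> push_cast <;> omega)
    exact Fin.ext (by omega)
  simp only [W, V] at h3 h4
  have h5 : ((e + 1 : ℕ) : ℤ) * ((M i₀ k).totalDegree + (v k).totalDegree) <
      ((e + 1 : ℕ) : ℤ) * ((M i₀ k₀).totalDegree + (v k₀).totalDegree) := by
    push_cast; linarith
  have h6 := lt_of_mul_lt_mul_left h5 (by positivity)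
  exact_mod_cast h6

section Cyclic

variable {K L : Type*} [Field K] [Field L] [Algebra K L] {e : ℕ}

/-- The automorphism of the matrix algebra that applies `σ` to the entries and shifts the rows and
columns cyclically. -/
def cyclicShift (σ : L ≃ₐ[K] L) :
    Matrix (Fin (e + 1)) (Fin (e + 1)) L ≃ₐ[K] Matrix (Fin (e + 1)) (Fin (e + 1)) L :=
  σ.mapMatrix.trans (Matrix.reindexAlgEquiv K L (Equiv.addRight 1).symm)

theorem cyclicShift_apply (σ : L ≃ₐ[K] L) (M : Matrix (Fin (e + 1)) (Fin (e + 1)) L)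
    (i k : Fin (e + 1)) : cyclicShift σ M i k = σ (M (i + 1) (k + 1)) := rfl

/-- The cyclic algebra attached to the automorphism `σ` and the element `s`, as an algebra of
matrices. -/
def cyclicAlgebra (σ : L ≃ₐ[K] L) (s : L) :
    Subalgebra K (Matrix (Fin (e + 1)) (Fin (e + 1)) L) where
  carrier := {M | M * Matrix.diagonal (cyclicWeight e s) =
    Matrix.diagonal (cyclicWeight e s) * cyclicShift σ M}
  mul_mem' := by
    intro M N hM hN
    simp only [Set.mem_ofPred_eq] at hM hN ⊢
    rw [mul_assoc, hN, ← mul_assoc, hM, mul_assoc, map_mul]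
  add_mem' := by
    intro M N hM hN
    simp only [Set.mem_ofPred_eq] at hM hN ⊢
    rw [add_mul, hM, hN, map_add, mul_add]
  algebraMap_mem' := by
    intro c
    simp only [Set.mem_ofPred_eq]
    rw [AlgEquiv.commutes, Algebra.commutes]

theorem mem_cyclicAlgebra {σ : L ≃ₐ[K] L} {s : L} {M : Matrix (Fin (e + 1)) (Fin (e + 1)) L} :
    M ∈ cyclicAlgebra σ s ↔
      ∀ i k, M i k * cyclicWeight e s k = cyclicWeight e s i * σ (M (i + 1) (k + 1)) := by
  change _ = _ ↔ _
  rw [← Matrix.ext_iff]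
  simp only [Matrix.mul_diagonal, Matrix.diagonal_mul, cyclicShift_apply]

theorem inverse_mem_cyclicAlgebra {σ : L ≃ₐ[K] L} {s : L}
    {M N : Matrix (Fin (e + 1)) (Fin (e + 1)) L} (hM : M ∈ cyclicAlgebra σ s)
    (h : M * N = 1) (h' : N * M = 1) : N ∈ cyclicAlgebra σ s := by
  change M * _ = _ at hM
  change N * _ = _
  calc N * Matrix.diagonal (cyclicWeight e s)
      = N * (Matrix.diagonal (cyclicWeight e s) * cyclicShift σ M) * cyclicShift σ N := by
        rw [mul_assoc, mul_assoc, ← map_mul, h, map_one, mul_one]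
    _ = Matrix.diagonal (cyclicWeight e s) * cyclicShift σ N := by
        rw [← hM, ← mul_assoc, h', one_mul]

/-- The algebra contains a diagonal matrix with distinct entries, whose Lagrange polynomials are the
diagonal matrix units, and the weighted cyclic permutation `P`, which shifts these to all the other
matrix units. -/
theorem span_cyclicAlgebra {σ : L ≃ₐ[K] L} {s : L} (hs : s ≠ 0) (hσs : σ s = s)
    (x : Fin (e + 1) → L) (hx : Function.Injective x) (hσx : ∀ i, σ (x (i + 1)) = x i) :
    Submodule.span L
      ((cyclicAlgebra σ s : Subalgebra K (Matrix (Fin (e + 1)) (Fin (e + 1)) L)) :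
      Set (Matrix (Fin (e + 1)) (Fin (e + 1)) L)) = ⊤ := by
  classical
  set D : Subalgebra K (Matrix (Fin (e + 1)) (Fin (e + 1)) L) := cyclicAlgebra σ s
  have hspan : Submodule.span L (D : Set (Matrix (Fin (e + 1)) (Fin (e + 1)) L)) =
      Subalgebra.toSubmodule (Algebra.adjoin L (D : Set _)) := by
    rw [Algebra.adjoin_eq_span]
    congr 1
    exact (congrArg SetLike.coe (Submonoid.closure_eq D.toSubmonoid)).symm
  have hw : ∀ i, cyclicWeight e s i ≠ 0 := fun i => by
    unfold cyclicWeight; split_ifs <;> simp [hs]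
  have hσw : ∀ i, σ (cyclicWeight e s i) = cyclicWeight e s i := fun i => by
    unfold cyclicWeight; split_ifs <;> simp [hσs]
  have hX : Matrix.diagonal x ∈
      Algebra.adjoin L (D : Set (Matrix (Fin (e + 1)) (Fin (e + 1)) L)) := by
    refine Algebra.subset_adjoin (mem_cyclicAlgebra.2 fun i k => ?_)
    by_cases h : i = k
    · subst h; simp [hσx, mul_comm]
    · rw [Matrix.diagonal_apply_ne _ h, Matrix.diagonal_apply_ne _ (by simpa using h)]
      simp
  let P : Matrix (Fin (e + 1)) (Fin (e + 1)) L := fun i k =>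
    if k = i + 1 then cyclicWeight e s i else 0
  have hP : P ∈ Algebra.adjoin L (D : Set (Matrix (Fin (e + 1)) (Fin (e + 1)) L)) := by
    refine Algebra.subset_adjoin (mem_cyclicAlgebra.2 fun i k => ?_)
    by_cases h : k = i + 1
    · simp [P, h, hσw]
    · simp [P, h]
  have hdiag : ∀ i, Matrix.single i i (1 : L) ∈
      Algebra.adjoin L (D : Set (Matrix (Fin (e + 1)) (Fin (e + 1)) L)) := fun i => by
    have h1 : Polynomial.aeval (Matrix.diagonal x) (Lagrange.basis Finset.univ x i) =
        Matrix.single i i (1 : L) := by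
      have := Polynomial.aeval_algHom_apply (Matrix.diagonalAlgHom L (n := Fin (e + 1)) (α := L)) x
        (Lagrange.basis Finset.univ x i)
      rw [Matrix.diagonalAlgHom_apply] at this
      rw [this, Matrix.diagonalAlgHom_apply, Polynomial.aeval_pi_apply,
        ← Matrix.diagonal_single]
      congr 1
      funext j
      rw [Polynomial.coe_aeval_eq_eval]
      by_cases h : i = j
      · subst h
        rw [Lagrange.eval_basis_self hx.injOn (Finset.mem_univ _), Pi.single_eq_same]
      · rw [Lagrange.eval_basis_of_ne h (Finset.mem_univ _), Pi.single_eq_of_ne (Ne.symm h)]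
    rw [← h1]
    exact Algebra.adjoin_mono (Set.singleton_subset_iff.2 hX) |>.trans
      (by rw [Algebra.adjoin_eq]) <| Polynomial.aeval_mem_adjoin_singleton L _
  have hsingle : ∀ i k, Matrix.single i k (1 : L) ∈
      Algebra.adjoin L (D : Set (Matrix (Fin (e + 1)) (Fin (e + 1)) L)) := fun i k => by
    rw [← add_sub_cancel i k]
    induction k - i using fin_induction_add_one with
    | h0 => rw [add_zero]; exact hdiag i
    | h t ih =>
      have h1 : Matrix.single i (i + (t + 1)) (1 : L) =
          (cyclicWeight e s (i + t))⁻¹ • (Matrix.single i (i + t) 1 * P) := by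
        ext a b
        rw [Matrix.smul_apply]
        by_cases ha : a = i
        · subst ha
          rw [Matrix.single_mul_apply_same]
          by_cases hb : b = a + (t + 1)
          · simp [hb, P, add_assoc, hw]
          · simp [P, ← add_assoc] at hb ⊢
            simp [hb, Ne.symm hb]
        · rw [Matrix.single_mul_apply_of_ne _ _ _ _ _ ha]
          simp [Ne.symm ha]
      rw [h1]
      exact Subalgebra.smul_mem _ (Subalgebra.mul_mem _ ih hP) _
  rw [hspan, eq_top_iff]
  intro M _
  rw [Matrix.matrix_eq_sum_single M]
  refine Submodule.sum_mem _ fun i _ => Submodule.sum_mem _ fun k _ => ?_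
  have : Matrix.single i k (M i k) = M i k • Matrix.single i k (1 : L) := by simp
  rw [this]
  exact Submodule.smul_mem _ _ (hsingle i k)

end Cyclic

end LeftRight

/-! ### Cyclic division algebras over rational function fields, and ranks of block matrices over
them. -/

namespace LeftRight

open scoped Kronecker

/-- The automorphism of the polynomial ring that subtracts `t` from the indices of the variables. -/
noncomputable def rotateVars (K : Type*) [Field K] (e : ℕ) (t : Fin (e + 1)) :
    MvPolynomial (Fin (e + 1)) K ≃ₐ[K] MvPolynomial (Fin (e + 1)) K :=
  MvPolynomial.renameEquiv K (Equiv.addRight t).symm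

theorem rotateVars_apply {K : Type*} [Field K] {e : ℕ} (t : Fin (e + 1))
    (f : MvPolynomial (Fin (e + 1)) K) :
    rotateVars K e t f = MvPolynomial.rename (fun i => i - t) f := by
  simp [rotateVars, MvPolynomial.renameEquiv_apply, sub_eq_add_neg]

theorem rotateVars_X {K : Type*} [Field K] {e : ℕ} (t i : Fin (e + 1)) :
    rotateVars K e t (MvPolynomial.X (i + t)) = MvPolynomial.X i := by
  simp [rotateVars_apply]

theorem rotateVars_zero {K : Type*} [Field K] {e : ℕ} (f : MvPolynomial (Fin (e + 1)) K) :
    rotateVars K e 0 f = f := by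
  rw [rotateVars_apply]
  simp only [sub_zero]
  exact MvPolynomial.rename_id_apply f

theorem rotateVars_rotateVars {K : Type*} [Field K] {e : ℕ} (t u : Fin (e + 1))
    (f : MvPolynomial (Fin (e + 1)) K) :
    rotateVars K e u (rotateVars K e t f) = rotateVars K e (t + u) f := by
  simp only [rotateVars_apply, MvPolynomial.rename_rename]
  congr 2
  funext i
  simp [sub_sub]

theorem totalDegree_rotateVars {K : Type*} [Field K] {e : ℕ} (t : Fin (e + 1))
    (f : MvPolynomial (Fin (e + 1)) K) : (rotateVars K e t f).totalDegree = f.totalDegree :=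
  MvPolynomial.totalDegree_renameEquiv _ _

theorem totalDegree_sum_X (K : Type*) [Field K] (e : ℕ) :
    (∑ i, MvPolynomial.X i : MvPolynomial (Fin (e + 1)) K).totalDegree = 1 := by
  refine MvPolynomial.IsHomogeneous.totalDegree
    (MvPolynomial.IsHomogeneous.sum _ _ _ fun i _ => MvPolynomial.isHomogeneous_X K i) ?_
  intro h
  have := congrArg (MvPolynomial.eval (Pi.single (0 : Fin (e + 1)) (1 : K))) h
  simp at this

/-- The norm, that is, the product of all rotations of `b`. A rotation-invariant denominator can be
cleared without disturbing the relation that defines `cyclicAlgebra`. -/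
theorem exists_rotateVars_invariant_dvd {K : Type*} [Field K] {e : ℕ}
    (b : MvPolynomial (Fin (e + 1)) K) (hb : b ≠ 0) :
    ∃ c, c ≠ 0 ∧ rotateVars K e 1 c = c ∧ b ∣ c := by
  refine ⟨∏ t, rotateVars K e t b, ?_, ?_, ?_⟩
  · exact Finset.prod_ne_zero_iff.2 fun t _ => by simpa using hb
  · rw [map_prod, ← Equiv.prod_comp (Equiv.addRight (1 : Fin (e + 1)))
      fun t => rotateVars K e t b]
    exact Finset.prod_congr rfl fun t _ => rotateVars_rotateVars _ _ _
  · have := Finset.dvd_prod_of_mem (fun t => rotateVars K e t b) (Finset.mem_univ 0)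
    rwa [rotateVars_zero] at this

theorem det_ne_zero_of_mem_cyclicAlgebra {K L : Type*} [Field K] {e : ℕ} [Field L] [Algebra K L]
    [Algebra (MvPolynomial (Fin (e + 1)) K) L] [IsFractionRing (MvPolynomial (Fin (e + 1)) K) L]
    (σ : L ≃ₐ[K] L)
    (hσ : ∀ f, σ (algebraMap (MvPolynomial (Fin (e + 1)) K) L f) =
      algebraMap _ L (rotateVars K e 1 f))
    (s : MvPolynomial (Fin (e + 1)) K) (hs : s.totalDegree = 1)
    (M : Matrix (Fin (e + 1)) (Fin (e + 1)) L)
    (hM : M ∈ cyclicAlgebra σ (algebraMap (MvPolynomial (Fin (e + 1)) K) L s)) (hM0 : M ≠ 0) :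
    M.det ≠ 0 := by
  intro hdet
  have hinj : Function.Injective (algebraMap (MvPolynomial (Fin (e + 1)) K) L) :=
    IsFractionRing.injective (MvPolynomial (Fin (e + 1)) K) L
  obtain ⟨b, hb⟩ := IsLocalization.exist_integer_multiples_of_finite 
      (nonZeroDivisors (MvPolynomial (Fin (e + 1)) K))
    fun q : Fin (e + 1) × Fin (e + 1) => M q.1 q.2
  obtain ⟨c, hc0, hτc, hbc⟩ := exists_rotateVars_invariant_dvd
    (b : MvPolynomial (Fin (e + 1)) K) (nonZeroDivisors.coe_ne_zero b)
  have hex : ∀ i k, ∃ f : MvPolynomial (Fin (e + 1)) K,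
      algebraMap _ L f = algebraMap _ L c * M i k := fun i k => by
    obtain ⟨g, hg⟩ := hb (i, k)
    obtain ⟨q, hq⟩ := hbc
    refine ⟨q * g, ?_⟩
    rw [map_mul, hg, hq, map_mul]
    simp only [Algebra.smul_def]
    ring
  obtain ⟨N, hN⟩ : ∃ N : Matrix (Fin (e + 1)) (Fin (e + 1)) (MvPolynomial (Fin (e + 1)) K),
      ∀ i k, algebraMap _ L (N i k) = algebraMap _ L c * M i k := by
    choose N hN using hex
    exact ⟨N, hN⟩
  have hc0' : algebraMap (MvPolynomial (Fin (e + 1)) K) L c ≠ 0 := by simpa using hc0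
  have hNM : N.map (algebraMap (MvPolynomial (Fin (e + 1)) K) L) =
      algebraMap (MvPolynomial (Fin (e + 1)) K) L c • M := by
    ext i k
    simp [hN]
  have hNdet : N.det = 0 := by
    apply hinj
    rw [RingHom.map_det, RingHom.mapMatrix_apply, hNM, Matrix.det_smul, hdet, mul_zero,
      map_zero]
  obtain ⟨v, hv, hv'⟩ := Matrix.exists_mulVec_eq_zero_iff.2 hNdet
  refine cyclic_mulVec_ne_zero s hs _ (totalDegree_rotateVars 1) N (fun i k => hinj ?_) ?_ v hv hv'
  · have hw : ∀ i, algebraMap (MvPolynomial (Fin (e + 1)) K) L (cyclicWeight e s i) =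
        cyclicWeight e (algebraMap (MvPolynomial (Fin (e + 1)) K) L s) i := fun i => by
      unfold cyclicWeight; split_ifs <;> simp
    rw [map_mul, map_mul, hN, ← hσ, hN, map_mul, hσ, hτc, hw, hw, mul_assoc,
      mem_cyclicAlgebra.1 hM]
    ring
  · intro h
    apply hM0
    ext i k
    have := hN i k
    rw [h] at this
    simpa [hc0'] using this

/-- Over every field `K` and for every `d ≥ 1` there are an extension field `L` and a `K`-subalgebra
of the `d × d` matrices over `L` that is a division ring and spans the matrix algebra over `L`. -/
theorem exists_division_subalgebra.{u} (K : Type u) [Field K] (e : ℕ) :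
    ∃ (L : Type u) (_ : Field L) (_ : Algebra K L)
      (D : Subalgebra K (Matrix (Fin (e + 1)) (Fin (e + 1)) L)),
      (∀ a ∈ D, a ≠ 0 → ∃ b ∈ D, a * b = 1 ∧ b * a = 1) ∧
      Submodule.span L (D : Set (Matrix (Fin (e + 1)) (Fin (e + 1)) L)) = ⊤ := by
  classical
  obtain ⟨L, _, _, _, _, _⟩ : ∃ (L : Type u) (_ : Field L) (_ : Algebra K L)
      (_ : Algebra (MvPolynomial (Fin (e + 1)) K) L)
      (_ : IsScalarTower K (MvPolynomial (Fin (e + 1)) K) L),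
      IsFractionRing (MvPolynomial (Fin (e + 1)) K) L :=
    ⟨FractionRing (MvPolynomial (Fin (e + 1)) K), inferInstance, inferInstance, inferInstance,
      inferInstance, inferInstance⟩
  have hs := totalDegree_sum_X K e
  have hτs : rotateVars K e 1 (∑ i, MvPolynomial.X i) = ∑ i, MvPolynomial.X i := by
    rw [map_sum, ← Equiv.sum_comp (Equiv.addRight (1 : Fin (e + 1)))]
    exact Finset.sum_congr rfl fun i _ => rotateVars_X 1 i
  -- All that matters about `s` is that it is rotation-invariant of degree one.
  generalize (∑ i, MvPolynomial.X i : MvPolynomial (Fin (e + 1)) K) = s at hs hτs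
  have hs0 : s ≠ 0 := by
    rintro rfl
    simp at hs
  let σ : L ≃ₐ[K] L := IsFractionRing.fieldEquivOfAlgEquiv K L L (rotateVars K e 1)
  have hσ : ∀ f, σ (algebraMap (MvPolynomial (Fin (e + 1)) K) L f) =
      algebraMap _ L (rotateVars K e 1 f) :=
    fun f => IsFractionRing.fieldEquivOfAlgEquiv_algebraMap K L L _ f
  have hinj : Function.Injective (algebraMap (MvPolynomial (Fin (e + 1)) K) L) :=
    IsFractionRing.injective (MvPolynomial (Fin (e + 1)) K) L
  refine ⟨L, inferInstance, inferInstance,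
    cyclicAlgebra σ (algebraMap (MvPolynomial (Fin (e + 1)) K) L s), ?_, ?_⟩
  · intro M hM hM0
    have hdet := det_ne_zero_of_mem_cyclicAlgebra σ hσ s hs M hM hM0
    have hu : IsUnit M.det := isUnit_iff_ne_zero.2 hdet
    exact ⟨M⁻¹, inverse_mem_cyclicAlgebra hM (M.mul_nonsing_inv hu) (M.nonsing_inv_mul hu),
      M.mul_nonsing_inv hu, M.nonsing_inv_mul hu⟩
  · refine span_cyclicAlgebra (by simpa using hs0) (by rw [hσ, hτs])
      (fun i => algebraMap (MvPolynomial (Fin (e + 1)) K) L (MvPolynomial.X i))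
      (hinj.comp (MvPolynomial.X_injective)) fun i => by
        rw [hσ, rotateVars_X]

/-- A square matrix over a division ring is the product of a left invertible and a right invertible
rectangular matrix. -/
theorem exists_rank_factorization {D : Type*} [DivisionRing D] {n : ℕ}
    (M : Matrix (Fin n) (Fin n) D) :
    ∃ (r : ℕ) (A A' : Matrix (Fin n) (Fin r) D) (B B' : Matrix (Fin r) (Fin n) D),
      M = A * B ∧ B' * A = 1 ∧ B * A' = 1 := by
  classical
  -- Over a noncommutative ring matrices act linearly on row vectors from the right, so matrix
  -- products appear in the reverse order of composition.
  let f : (Fin n → D) →ₗ[D] (Fin n → D) := LinearMap.toMatrixRight'.symm M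
  let E := LinearEquiv.ofFinrankEq (LinearMap.range f)
    (Fin (Module.finrank D (LinearMap.range f)) → D) (Module.finrank_fin_fun D).symm
  let g : (Fin n → D) →ₗ[D] (Fin (Module.finrank D (LinearMap.range f)) → D) :=
    E.toLinearMap ∘ₗ f.rangeRestrict
  let h : (Fin (Module.finrank D (LinearMap.range f)) → D) →ₗ[D] (Fin n → D) :=
    (LinearMap.range f).subtype ∘ₗ E.symm.toLinearMap
  obtain ⟨g', hg'⟩ := g.exists_rightInverse_of_surjective
    (LinearMap.range_eq_top.2 (E.surjective.comp f.surjective_rangeRestrict))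
  obtain ⟨h', hh'⟩ := h.exists_leftInverse_of_injective
    (LinearMap.ker_eq_bot.2 (Subtype.val_injective.comp E.symm.injective))
  have hf : h ∘ₗ g = f := by
    refine LinearMap.ext fun x => ?_
    simp [h, g]
  refine ⟨_, LinearMap.toMatrixRight' g, LinearMap.toMatrixRight' h', LinearMap.toMatrixRight' h,
    LinearMap.toMatrixRight' g', ?_, ?_, ?_⟩
  · rw [← LinearMap.toMatrixRight'_comp, hf]
    exact (LinearEquiv.apply_symm_apply _ _).symm
  · rw [← LinearMap.toMatrixRight'_comp, hg', LinearMap.toMatrixRight'_id]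
  · rw [← LinearMap.toMatrixRight'_comp, hh', LinearMap.toMatrixRight'_id]

theorem comp_mul_comp {L α β γ δ : Type*} [CommRing L] [Fintype β] [Fintype δ]
    (A : Matrix α β (Matrix δ δ L)) (B : Matrix β γ (Matrix δ δ L)) :
    Matrix.comp α β δ δ L A * Matrix.comp β γ δ δ L B = Matrix.comp α γ δ δ L (A * B) := by
  ext ⟨a, i⟩ ⟨c, k⟩
  simp only [Matrix.mul_apply, Matrix.comp_apply, Fintype.sum_prod_type, Matrix.sum_apply]

/-- The rank of a block matrix with blocks in a division ring of `d × d` matrices is divisible by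
`d`. -/
theorem dvd_rank_comp {K L : Type*} [Field K] [Field L] [Algebra K L] {d n : ℕ} [NeZero d]
    (D : Subalgebra K (Matrix (Fin d) (Fin d) L))
    (hD : ∀ a ∈ D, a ≠ 0 → ∃ b ∈ D, a * b = 1 ∧ b * a = 1)
    (M : Matrix (Fin n) (Fin n) (Matrix (Fin d) (Fin d) L)) (hM : ∀ a b, M a b ∈ D) :
    d ∣ (Matrix.comp _ _ _ _ L M).rank := by
  classical
  let _ : DivisionRing D := DivisionRing.ofIsUnitOrEqZero fun a => by
    by_cases h : a = 0
    · exact Or.inr h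
    · obtain ⟨b, hb, h1, h2⟩ := hD a a.2 (fun h' => h (Subtype.ext h'))
      exact Or.inl ⟨⟨a, ⟨b, hb⟩, Subtype.ext h1, Subtype.ext h2⟩, rfl⟩
  obtain ⟨r, A, A', B, B', h1, h2, h3⟩ := exists_rank_factorization (D := D)
    (fun a b => (⟨M a b, hM a b⟩ : D))
  let φ : D →+* Matrix (Fin d) (Fin d) L := D.val.toRingHom
  have hM' : M = A.map φ * B.map φ := by
    rw [← Matrix.map_mul, ← h1]
    rfl
  have h2' : B'.map φ * A.map φ = 1 := by
    rw [← Matrix.map_mul, h2, Matrix.map_one _ (map_zero φ) (map_one φ)]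
  have h3' : B.map φ * A'.map φ = 1 := by
    rw [← Matrix.map_mul, h3, Matrix.map_one _ (map_zero φ) (map_one φ)]
  -- `M = A * B` through width `r` bounds the rank above; `B' * M * A' = 1` of size `r` bounds it
  -- below.
  have hrank : (Matrix.comp _ _ _ _ L M).rank = r * d := by
    apply le_antisymm
    · rw [hM', ← comp_mul_comp]
      refine (Matrix.rank_mul_le_left _ _).trans ((Matrix.rank_le_card_width _).trans_eq (by simp))
    · have h4 : Matrix.comp _ _ _ _ L (B'.map φ) * Matrix.comp _ _ _ _ L M *
          Matrix.comp _ _ _ _ L (A'.map φ) = 1 := by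
        rw [comp_mul_comp, comp_mul_comp, hM', ← Matrix.mul_assoc, h2', Matrix.one_mul, h3',
          Matrix.comp_one]
      have h5 := (Matrix.rank_mul_le_left (Matrix.comp _ _ _ _ L (B'.map φ) *
        Matrix.comp _ _ _ _ L M) (Matrix.comp _ _ _ _ L (A'.map φ))).trans
        (Matrix.rank_mul_le_right _ _)
      rw [h4, Matrix.rank_one] at h5
      simpa using h5
  exact ⟨r, by rw [hrank, mul_comm]⟩

end LeftRight

namespace LeftRight

open scoped Kronecker

/-! ### Blow-ups and the regularity lemma -/

/-- The blow-up `∑ X_i ⊗ T_i`. -/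
def blowup {K ι κ : Type*} [Field K] {n m : ℕ} (X : MatTuple K n m) (T : Fin m → Matrix ι κ K) :
    Matrix (Fin n × ι) (Fin n × κ) K :=
  ∑ i, X i ⊗ₖ T i

theorem blowup_apply {K ι κ : Type*} [Field K] {n m : ℕ} (X : MatTuple K n m)
    (T : Fin m → Matrix ι κ K) (p : Fin n × ι) (q : Fin n × κ) :
    blowup X T p q = ∑ j, X j p.1 q.1 * T j p.2 q.2 := by
  simp [blowup, Matrix.sum_apply, Matrix.kroneckerMap_apply]

theorem blowup_map {K L ι κ : Type*} [Field K] [Field L] (φ : K →+* L) {n m : ℕ}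
    (X : MatTuple K n m) (T : Fin m → Matrix ι κ K) :
    blowup (fun j => (X j).map φ) (fun j => (T j).map φ) = (blowup X T).map φ := by
  ext p q
  simp [blowup_apply]

/-- The blow-up by matrices of independent variables. -/
noncomputable def genericBlowup {K : Type*} [Field K] {n m : ℕ} (ι κ : Type*)
    (X : MatTuple K n m) :
    Matrix (Fin n × ι) (Fin n × κ) (MvPolynomial (Fin m × ι × κ) K) :=
  fun p q => ∑ j, MvPolynomial.C (X j p.1 q.1) * MvPolynomial.X (j, p.2, q.2)

theorem genericBlowup_map_eval {K ι κ : Type*} [Field K] {n m : ℕ} (X : MatTuple K n m)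
    (y : Fin m × ι × κ → K) :
    (genericBlowup ι κ X).map (MvPolynomial.eval y) =
      blowup X (fun j => Matrix.of fun i k => y (j, i, k)) := by
  ext p q
  simp [blowup_apply, genericBlowup]

theorem exists_rank_blowup_le_of_map {K L : Type*} [Field K] [Infinite K] [Field L]
    (φ : K →+* L) {ι κ : Type*} [Fintype ι] [Fintype κ] {n m : ℕ} (X : MatTuple K n m)
    (T : Fin m → Matrix ι κ L) :
    ∃ T' : Fin m → Matrix ι κ K,
      (blowup (fun j => (X j).map φ) T).rank ≤ (blowup X T').rank := by
  obtain ⟨y, hy, hr⟩ := exists_rank_le_of_infinite (Set.infinite_range_of_injective φ.injective)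
    (genericBlowup ι κ (fun j => (X j).map φ)) (fun p => T p.1 p.2.1 p.2.2)
  choose z hz using hy
  refine ⟨fun j => Matrix.of fun i k => z (j, i, k), ?_⟩
  rw [genericBlowup_map_eval, genericBlowup_map_eval] at hr
  rw [← rank_map_ringHom φ, ← blowup_map]
  have hT : (fun j => (Matrix.of fun i k => z (j, i, k) : Matrix ι κ K).map φ) =
      fun j => Matrix.of fun i k => y (j, i, k) := by
    funext j
    ext i k
    simp [hz]
  rw [hT]
  exact hr

theorem exists_basis_mem_of_span_eq_top {L V : Type*} [Field L] [AddCommGroup V] [Module L V]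
    [Module.Finite L V] {s : Set V} (hs : Submodule.span L s = ⊤) :
    ∃ b : Module.Basis (Fin (Module.finrank L V)) L V, ∀ i, b i ∈ s := by
  let b := Module.Basis.ofSpan hs.ge
  have := Module.Finite.finite_basis b
  let e := Finite.equivFinOfCardEq (Module.finrank_eq_nat_card_basis b).symm
  exact ⟨b.reindex e, fun i => Module.Basis.ofSpan_subset hs.ge ⟨e.symm i, by simp [b]⟩⟩

/-- Expand `T` over `L` in a basis taken from the division algebra `D`. Moving the coordinates to a
generic point of `K` does not lower the rank and puts the tuple into `D`, where ranks are multiples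
of `e + 1`. A second generic choice returns to matrices over `K`. -/
theorem exists_rank_blowup_between {K : Type*} [Field K] [Infinite K] {n m e : ℕ}
    (X : MatTuple K n m) (T : MatTuple K (e + 1) m) :
    ∃ (s : ℕ) (T' : MatTuple K (e + 1) m),
      (blowup X T).rank ≤ (e + 1) * s ∧ (e + 1) * s ≤ (blowup X T').rank := by
  classical
  obtain ⟨L, _, _, D, hD, hspan⟩ := exists_division_subalgebra K e
  let φ := algebraMap K L
  obtain ⟨b, hb⟩ := exists_basis_mem_of_span_eq_top hspan
  let ν := Fin (Module.finrank L (Matrix (Fin (e + 1)) (Fin (e + 1)) L))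
  let P : Matrix (Fin n × Fin (e + 1)) (Fin n × Fin (e + 1)) (MvPolynomial (Fin m × ν) L) :=
    fun p q => ∑ j, MvPolynomial.C (φ (X j p.1 q.1)) *
      ∑ l, MvPolynomial.X (j, l) * MvPolynomial.C (b l p.2 q.2)
  have hP : ∀ y : Fin m × ν → L, P.map (MvPolynomial.eval y) =
      blowup (fun j => (X j).map φ) (fun j => ∑ l, y (j, l) • b l) := fun y => by
    ext p q
    rw [Matrix.map_apply]
    simp [P, blowup_apply, Matrix.sum_apply]
    rfl
  obtain ⟨y, hy, hr⟩ := exists_rank_le_of_infinite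
    (Set.infinite_range_of_injective φ.injective) P (fun q => b.repr ((T q.1).map φ) q.2)
  rw [hP, hP] at hr
  have hrepr : (fun j => ∑ l, b.repr ((T j).map φ) l • b l) = fun j => (T j).map φ :=
    funext fun j => b.sum_repr _
  rw [hrepr, blowup_map, rank_map_ringHom] at hr
  choose z hz using hy
  have hmem : ∀ j, ∑ l, y (j, l) • b l ∈ D := fun j => by
    refine Subalgebra.sum_mem _ fun l _ => ?_
    rw [← hz, algebraMap_smul]
    exact Subalgebra.smul_mem _ (hb l) _
  obtain ⟨s, hs⟩ := dvd_rank_comp D hD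
    (Matrix.of fun a c => ∑ j, X j a c • ∑ l, y (j, l) • b l : Matrix (Fin n) (Fin n) _)
    (fun a c => by
      rw [Matrix.of_apply]
      exact Subalgebra.sum_mem _ fun j _ => Subalgebra.smul_mem _ (hmem j) _)
  have hcomp : Matrix.comp _ _ _ _ L
      (Matrix.of fun a c => ∑ j, X j a c • ∑ l, y (j, l) • b l : Matrix (Fin n) (Fin n) _) =
      blowup (fun j => (X j).map φ) (fun j => ∑ l, y (j, l) • b l) := by
    ext p q
    simp only [Matrix.comp_apply, Matrix.of_apply, Matrix.sum_apply, Matrix.smul_apply,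
      blowup_apply, Matrix.map_apply]
    refine Finset.sum_congr rfl fun j _ => ?_
    rw [Algebra.smul_def]
  rw [hcomp] at hs
  obtain ⟨T', hT'⟩ := exists_rank_blowup_le_of_map φ X (fun j => ∑ l, y (j, l) • b l)
  exact ⟨s, T', hs ▸ hr, hs ▸ hT'⟩

theorem exists_max_rank_blowup {K ι κ : Type*} [Field K] [Fintype ι] [Fintype κ] {n m : ℕ}
    (X : MatTuple K n m) :
    ∃ T : Fin m → Matrix ι κ K, ∀ T' : Fin m → Matrix ι κ K,
      (blowup X T').rank ≤ (blowup X T).rank := by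
  have hfin : (Set.range fun T : Fin m → Matrix ι κ K => (blowup X T).rank).Finite :=
    (Set.finite_le_nat (Fintype.card (Fin n × κ))).subset (by
      rintro _ ⟨T, rfl⟩
      exact Matrix.rank_le_card_width _)
  obtain ⟨_, ⟨T, rfl⟩, hT⟩ := Set.exists_max_image _ id hfin ⟨_, ⟨0, rfl⟩⟩
  exact ⟨T, fun T' => hT _ ⟨T', rfl⟩⟩

/-- **Regularity lemma**: the maximal rank of a blow-up by `d × d` matrices is divisible by `d`. -/
theorem dvd_rank_blowup_of_max {K : Type*} [Field K] [Infinite K] {n m d : ℕ} (hd : 0 < d)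
    (X : MatTuple K n m) (T : MatTuple K d m)
    (hT : ∀ T' : MatTuple K d m, (blowup X T').rank ≤ (blowup X T).rank) :
    d ∣ (blowup X T).rank := by
  obtain ⟨e, rfl⟩ := Nat.exists_eq_add_one_of_ne_zero hd.ne'
  obtain ⟨s, T', h1, h2⟩ := exists_rank_blowup_between X T
  exact ⟨s, le_antisymm h1 (h2.trans (hT T'))⟩

end LeftRight

namespace LeftRight

open scoped Kronecker

/-! ### Wong sequences -/

section Chain

variable {K S V W : Type*} [Field K] [AddCommGroup S] [Module K S] [AddCommGroup V] [Module K V]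
  [AddCommGroup W] [Module K W]

/-- The kernel of the block bidiagonal map with `M` on the diagonal and `B (s 0), …, B (s (k - 1))`
below the diagonal. -/
def chainKer (M : V →ₗ[K] W) (B : S →ₗ[K] V →ₗ[K] W) (s : ℕ → S) (k : ℕ) :
    Submodule K (Fin (k + 1) → V) where
  carrier := {x | M (x 0) = 0 ∧ ∀ j : Fin k, M (x j.succ) + B (s j) (x j.castSucc) = 0}
  add_mem' := by
    rintro x y ⟨hx, hx'⟩ ⟨hy, hy'⟩
    refine ⟨by simp [hx, hy], fun j => ?_⟩
    rw [Pi.add_apply, Pi.add_apply, map_add, map_add, add_add_add_comm, hx', hy', add_zero]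
  zero_mem' := by simp
  smul_mem' := by
    rintro c x ⟨hx, hx'⟩
    refine ⟨by simp [hx], fun j => ?_⟩
    rw [Pi.smul_apply, Pi.smul_apply, map_smul, map_smul, ← smul_add, hx', smul_zero]

/-- Forgetting the last component of an element of `chainKer`. -/
def chainRestrict (M : V →ₗ[K] W) (B : S →ₗ[K] V →ₗ[K] W) (s : ℕ → S) (k : ℕ) :
    chainKer M B s (k + 1) →ₗ[K] chainKer M B s k where
  toFun x := ⟨fun j => x.1 j.castSucc, x.2.1, fun j => x.2.2 j.castSucc⟩
  map_add' _ _ := rfl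
  map_smul' _ _ := rfl

/-- The vectors that are reached from the kernel of `M` by steps `v ↦ M⁻¹ (B s v)`. -/
inductive Reachable (M : V →ₗ[K] W) (B : S →ₗ[K] V →ₗ[K] W) : V → Prop
  | ker (v : V) (hv : M v = 0) : Reachable M B v
  | step (v u : V) (s : S) (hv : Reachable M B v) (h : M u = B s v) : Reachable M B u

theorem Reachable.exists_chain {M : V →ₗ[K] W} {B : S →ₗ[K] V →ₗ[K] W} {v : V}
    (hv : Reachable M B v) :
    ∃ (k : ℕ) (s : ℕ → S) (x : Fin (k + 1) → V), x ∈ chainKer M B s k ∧ x (Fin.last k) = v := by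
  induction hv with
  | ker v hv => exact ⟨0, 0, fun _ => v, ⟨hv, fun j => j.elim0⟩, rfl⟩
  | step v u t _ h ih =>
    obtain ⟨k, s, x, hx, rfl⟩ := ih
    -- The sign turns `M u = B t v` into the equation `M u + B (-t) v = 0` of `chainKer`.
    refine ⟨k + 1, Function.update s k (-t), Fin.snoc x u, ⟨?_, fun j => ?_⟩, by simp⟩
    · rw [← Fin.castSucc_zero, Fin.snoc_castSucc]
      exact hx.1
    · rw [Fin.snoc_castSucc]
      refine Fin.lastCases ?_ (fun j => ?_) j
      · rw [Fin.succ_last, Fin.snoc_last, Fin.val_last, Function.update_self, h]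
        simp
      · rw [← Fin.castSucc_succ, Fin.snoc_castSucc, Fin.val_castSucc,
          Function.update_of_ne j.isLt.ne]
        exact hx.2 j

variable [FiniteDimensional K V]

theorem finrank_ker_chainRestrict_le (M : V →ₗ[K] W) (B : S →ₗ[K] V →ₗ[K] W) (s : ℕ → S) (k : ℕ) :
    Module.finrank K (LinearMap.ker (chainRestrict M B s k)) ≤
      Module.finrank K (LinearMap.ker M) := by
  have h0 : ∀ x : LinearMap.ker (chainRestrict M B s k), ∀ j : Fin (k + 1),
      x.1.1 j.castSucc = 0 := fun x j => congrFun (congrArg Subtype.val x.2) j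
  let f : LinearMap.ker (chainRestrict M B s k) →ₗ[K] LinearMap.ker M :=
    { toFun := fun x => ⟨x.1.1 (Fin.last (k + 1)), by
        have h1 := x.1.2.2 (Fin.last k)
        rw [h0, map_zero, add_zero] at h1
        exact h1⟩
      map_add' := fun _ _ => rfl
      map_smul' := fun _ _ => rfl }
  refine LinearMap.finrank_le_finrank_of_injective (f := f) fun x y hxy => ?_
  refine Subtype.ext (Subtype.ext (funext fun j => ?_))
  refine Fin.lastCases ?_ (fun j => ?_) j
  · exact congrArg Subtype.val hxy
  · rw [h0, h0]

theorem finrank_chainKer_le (M : V →ₗ[K] W) (B : S →ₗ[K] V →ₗ[K] W) (s : ℕ → S) (k : ℕ) :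
    Module.finrank K (chainKer M B s k) ≤ (k + 1) * Module.finrank K (LinearMap.ker M) := by
  induction k with
  | zero =>
    let f : chainKer M B s 0 →ₗ[K] LinearMap.ker M :=
      { toFun := fun x => ⟨x.1 0, x.2.1⟩
        map_add' := fun _ _ => rfl
        map_smul' := fun _ _ => rfl }
    refine le_of_le_of_eq ?_ (by rw [zero_add, one_mul] :
      Module.finrank K (LinearMap.ker M) = (0 + 1) * Module.finrank K (LinearMap.ker M))
    refine LinearMap.finrank_le_finrank_of_injective (f := f) fun x y hxy => ?_
    refine Subtype.ext (funext fun j => ?_)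
    rw [show j = 0 from Fin.ext (by omega)]
    exact congrArg Subtype.val hxy
  | succ k ih =>
    have h1 := LinearMap.finrank_range_add_finrank_ker (chainRestrict M B s k)
    have h2 := finrank_ker_chainRestrict_le M B s k
    have h3 := Submodule.finrank_le (LinearMap.range (chainRestrict M B s k))
    rw [add_mul, one_mul]
    omega

/-- Each step of a chain adds at most `dim ker M` to the dimension. When the upper bound is attained
for all lengths, every restriction map is onto, so a chain ending in `v` can be continued with any
parameter `t`. -/
theorem Reachable.mem_range {M : V →ₗ[K] W} {B : S →ₗ[K] V →ₗ[K] W}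
    (hM : ∀ s k, (k + 1) * Module.finrank K (LinearMap.ker M) ≤
      Module.finrank K (chainKer M B s k))
    {v : V} (hv : Reachable M B v) (t : S) : B t v ∈ LinearMap.range M := by
  obtain ⟨k, s, x, hx, rfl⟩ := hv.exists_chain
  -- Chains of length `k` only involve `s 0, …, s (k - 1)`, so the value at `k` is free.
  let s' := Function.update s k t
  have hx' : x ∈ chainKer M B s' k := by
    refine ⟨hx.1, fun j => ?_⟩
    have hs' : s' j = s j := Function.update_of_ne j.isLt.ne _ _
    rw [hs']
    exact hx.2 j
  have hsurj : LinearMap.range (chainRestrict M B s' k) = ⊤ := by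
    apply Submodule.eq_top_of_finrank_eq
    apply le_antisymm (Submodule.finrank_le _)
    have h1 := LinearMap.finrank_range_add_finrank_ker (chainRestrict M B s' k)
    have h2 := finrank_ker_chainRestrict_le M B s' k
    have h3 := finrank_chainKer_le M B s' k
    have h4 := hM s' (k + 1)
    rw [add_mul, one_mul] at h4
    omega
  obtain ⟨y, hy⟩ := LinearMap.range_eq_top.1 hsurj ⟨x, hx'⟩
  have h1 := y.2.2 (Fin.last k)
  have h2 : y.1 (Fin.last k).castSucc = x (Fin.last k) :=
    congrFun (congrArg Subtype.val hy) (Fin.last k)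
  have hs' : s' k = t := Function.update_self _ _ _
  rw [h2, Fin.val_last, hs'] at h1
  exact ⟨-y.1 (Fin.last k).succ, by rw [map_neg]; exact neg_eq_of_add_eq_zero_right h1⟩

theorem finrank_comap_of_le_range [FiniteDimensional K W] (M : V →ₗ[K] W) (P : Submodule K W)
    (hP : P ≤ LinearMap.range M) :
    Module.finrank K (P.comap M) = Module.finrank K P + Module.finrank K (LinearMap.ker M) := by
  have h1 := LinearMap.finrank_range_add_finrank_ker (M.domRestrict (P.comap M))
  rw [LinearMap.range_domRestrict, Submodule.map_comap_eq, inf_eq_right.2 hP] at h1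
  have h2 : Module.finrank K (LinearMap.ker (M.domRestrict (P.comap M))) =
      Module.finrank K (LinearMap.ker M) := by
    rw [LinearMap.ker_domRestrict]
    exact (Submodule.comapSubtypeEquivOfLe (LinearMap.ker_le_comap M)).finrank_eq
  omega

/-- `P` is the limit of the Wong sequence and `Q` its image under the family. Since `Q` lies in the
range of `M`, its preimage has dimension `dim Q + dim ker M`, and this preimage is contained in `P`.
-/
theorem exists_shrunk_of_le_finrank_chainKer [FiniteDimensional K W] (M : V →ₗ[K] W)
    (B : S →ₗ[K] V →ₗ[K] W)
    (hM : ∀ s k, (k + 1) * Module.finrank K (LinearMap.ker M) ≤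
      Module.finrank K (chainKer M B s k)) :
    ∃ (P : Submodule K V) (Q : Submodule K W), (∀ s, ∀ v ∈ P, B s v ∈ Q) ∧
      Module.finrank K Q + Module.finrank K (LinearMap.ker M) ≤ Module.finrank K P := by
  let P : Submodule K V := Submodule.span K {v | Reachable M B v}
  let Q : Submodule K W := Submodule.span K {w | ∃ v s, Reachable M B v ∧ B s v = w}
  have hQ : Q ≤ LinearMap.range M := Submodule.span_le.2 (by
    rintro _ ⟨v, s, hv, rfl⟩
    exact hv.mem_range hM s)
  refine ⟨P, Q, fun s v hv => ?_, ?_⟩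
  · have : P ≤ Q.comap (B s) := Submodule.span_le.2 fun v hv =>
      Submodule.subset_span ⟨v, s, hv, rfl⟩
    exact this hv
  · rw [← finrank_comap_of_le_range M Q hQ]
    apply Submodule.finrank_mono
    have hker : LinearMap.ker M ≤ P := fun v hv => Submodule.subset_span (Reachable.ker v hv)
    have hQP : Q ≤ P.map M := Submodule.span_le.2 (by
      rintro _ ⟨v, s, hv, rfl⟩
      obtain ⟨u, hu⟩ := hv.mem_range hM s
      exact ⟨u, Submodule.subset_span (Reachable.step v u s hv hu), hu⟩)
    calc Q.comap M ≤ (P.map M).comap M := Submodule.comap_mono hQP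
      _ = P ⊔ LinearMap.ker M := Submodule.comap_map_eq _ _
      _ = P := sup_eq_left.2 hker

end Chain

end LeftRight

namespace LeftRight

open scoped Kronecker

/-! ### Shrunk subspaces -/

/-- The tuple `X` maps some subspace into a subspace of smaller dimension. -/
def HasShrunkSubspace {K : Type*} [Field K] {n m : ℕ} (X : MatTuple K n m) : Prop :=
  ∃ U W : Submodule K (Fin n → K), (∀ i, ∀ u ∈ U, (X i).mulVec u ∈ W) ∧
    Module.finrank K W < Module.finrank K U

/-- The blow-up, as a linear family of linear maps. -/
def blowupLin {K : Type*} (ι κ : Type*) [Field K] [Fintype κ] {n m : ℕ} (X : MatTuple K n m) :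
    (Fin m → Matrix ι κ K) →ₗ[K] (Fin n × κ → K) →ₗ[K] (Fin n × ι → K) where
  toFun T := (blowup X T).mulVecLin
  map_add' S T := by
    rw [← Matrix.mulVecLin_add]
    congr 1
    ext p q
    simp [blowup_apply, mul_add, Finset.sum_add_distrib]
  map_smul' c T := by
    have : blowup X (c • T) = c • blowup X T := by
      ext p q
      simp [blowup_apply, Finset.mul_sum, mul_left_comm]
    refine LinearMap.ext fun x => ?_
    simp [this]

theorem blowupLin_apply {K ι κ : Type*} [Field K] [Fintype κ] {n m : ℕ} (X : MatTuple K n m)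
    (T : Fin m → Matrix ι κ K) (x : Fin n × κ → K) :
    blowupLin ι κ X T x = (blowup X T).mulVec x := rfl

theorem blowup_submatrix {K ι κ ι' κ' : Type*} [Field K] {n m : ℕ} (X : MatTuple K n m)
    (T : Fin m → Matrix ι κ K) (f : ι' → ι) (g : κ' → κ) :
    blowup X (fun j => (T j).submatrix f g) =
      (blowup X T).submatrix (Prod.map id f) (Prod.map id g) := by
  ext p q
  simp [blowup_apply]

theorem rank_blowup_reindex {K ι κ : Type*} [Field K] [Fintype ι] [Fintype κ] {n m : ℕ}
    (X : MatTuple K n m) (T : Fin m → Matrix ι ι K) (e : κ ≃ ι) :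
    (blowup X (fun j => (T j).submatrix e e)).rank = (blowup X T).rank := by
  rw [blowup_submatrix]
  exact Matrix.rank_submatrix (blowup X T) ((Equiv.refl (Fin n)).prodCongr e)
    ((Equiv.refl (Fin n)).prodCongr e)

/-- The components of a vector of a blow-up. -/
def component {K κ : Type*} [Field K] {n : ℕ} (k : κ) : (Fin n × κ → K) →ₗ[K] (Fin n → K) :=
  LinearMap.funLeft K K fun a => (a, k)

theorem component_apply {K κ : Type*} [Field K] {n : ℕ} (k : κ) (x : Fin n × κ → K) (a : Fin n) :
    component k x a = x (a, k) := rfl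

/-- The family of vectors with a given family of components. -/
def assemble {K κ : Type*} [Field K] {n : ℕ} : (κ → Fin n → K) →ₗ[K] (Fin n × κ → K) where
  toFun w p := w p.2 p.1
  map_add' _ _ := rfl
  map_smul' _ _ := rfl

theorem component_blowup {K ι κ : Type*} [Field K] [Fintype κ] {n m : ℕ} (X : MatTuple K n m)
    (T : Fin m → Matrix ι κ K) (x : Fin n × κ → K) (i : ι) :
    component i ((blowup X T).mulVec x) =
      ∑ j, ∑ k, T j i k • (X j).mulVec (component k x) := by
  ext a
  simp only [component_apply, Matrix.mulVec, dotProduct, blowup_apply, Finset.sum_apply,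
    Pi.smul_apply, smul_eq_mul, Fintype.sum_prod_type, Finset.sum_mul, Finset.mul_sum]
  conv_lhs => enter [2, b]; rw [Finset.sum_comm]
  rw [Finset.sum_comm]
  refine Finset.sum_congr rfl fun j _ => ?_
  rw [Finset.sum_comm]
  exact Finset.sum_congr rfl fun k _ => Finset.sum_congr rfl fun b _ => by ring

/-- `U` is generated by all components of vectors of `P`, and `W` consists of the vectors that lie
in `Q` whichever slot they are placed in. Hence `dim P ≤ d * dim U` and `d * dim W ≤ dim Q`. -/
theorem hasShrunkSubspace_of_blowup {K : Type*} [Field K] {n m d : ℕ} (X : MatTuple K n m)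
    (P Q : Submodule K (Fin n × Fin d → K))
    (hPQ : ∀ T : MatTuple K d m, ∀ x ∈ P, (blowup X T).mulVec x ∈ Q)
    (h : Module.finrank K Q < Module.finrank K P) : HasShrunkSubspace X := by
  classical
  let U : Submodule K (Fin n → K) := ⨆ k, P.map (component k)
  let W : Submodule K (Fin n → K) :=
    ⨅ k : Fin d, Q.comap (assemble ∘ₗ LinearMap.single K (fun _ => Fin n → K) k)
  refine ⟨U, W, fun i u hu => ?_, ?_⟩
  · have : U ≤ W.comap (X i).mulVecLin := iSup_le fun k => by
      rintro _ ⟨x, hx, rfl⟩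
      refine (Submodule.mem_iInf _).2 fun l => ?_
      change assemble (Pi.single l ((X i).mulVec (component k x))) ∈ Q
      -- The matrix unit at `(l, k)` in position `i` sends `x` to `X i` applied to its `k`-th
      -- component, placed in slot `l`.
      convert hPQ (Pi.single i (Matrix.single l k 1)) x hx using 1
      ext ⟨a, b⟩
      have h1 := congrFun (component_blowup X (Pi.single i (Matrix.single l k 1)) x b) a
      rw [component_apply] at h1
      rw [h1, Finset.sum_eq_single i, Finset.sum_eq_single k]
      · by_cases hb : b = l
        · subst hb; simp [assemble]
        · simp [assemble, hb, Ne.symm hb]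
      · intro c _ hc
        simp [Ne.symm hc]
      · simp
      · intro c _ hc
        simp [hc]
      · simp
    exact this hu
  · let f : P →ₗ[K] (Fin d → U) := LinearMap.pi fun k =>
      ((component k).domRestrict P).codRestrict U fun x =>
        (le_iSup (fun k => P.map (component k)) k) ⟨x, x.2, rfl⟩
    have hf : Function.Injective f := fun x y hxy => by
      refine Subtype.ext (funext fun p => ?_)
      exact congrFun (congrArg Subtype.val (congrFun hxy p.2)) p.1
    let g : (Fin d → W) →ₗ[K] Q :=
      (assemble ∘ₗ LinearMap.compLeft W.subtype (Fin d)).codRestrict Q fun w => by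
        have : (LinearMap.compLeft W.subtype (Fin d)) w = ∑ k, Pi.single k (w k : Fin n → K) :=
          (Finset.univ_sum_single _).symm
        rw [LinearMap.comp_apply, this, map_sum]
        exact Submodule.sum_mem _ fun k _ => (Submodule.mem_iInf _).1 (w k).2 k
    have hg : Function.Injective g := fun x y hxy => by
      refine funext fun k => Subtype.ext (funext fun a => ?_)
      exact congrFun (congrArg Subtype.val hxy) (a, k)
    have h1 := LinearMap.finrank_le_finrank_of_injective hf
    have h2 := LinearMap.finrank_le_finrank_of_injective hg
    rw [Module.finrank_pi_fintype, Finset.sum_const, Finset.card_univ, Fintype.card_fin,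
      smul_eq_mul] at h1 h2
    by_contra h3
    have := Nat.mul_le_mul_left d (not_lt.1 h3)
    omega

theorem finrank_ker_blowupLin {K ι κ : Type*} [Field K] [Fintype κ] {n m : ℕ}
    (X : MatTuple K n m) (T : Fin m → Matrix ι κ K) :
    (blowup X T).rank + Module.finrank K (LinearMap.ker (blowupLin ι κ X T)) =
      n * Fintype.card κ := by
  have := LinearMap.finrank_range_add_finrank_ker (blowupLin ι κ X T)
  simp only [Module.finrank_fintype_fun_eq_card, Fintype.card_prod, Fintype.card_fin] at this
  exact this

/-- The tuple of block bidiagonal matrices with the blocks `T` on the diagonal and `s l` below. -/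
def bidiagonal {K : Type*} [Field K] {m d : ℕ} (T : MatTuple K d m) (s : ℕ → MatTuple K d m)
    (k : ℕ) : Fin m → Matrix (Fin d × Fin (k + 1)) (Fin d × Fin (k + 1)) K :=
  fun i => Matrix.of fun p q =>
    (if q.2 = p.2 then T i else if (q.2 : ℕ) + 1 = p.2 then s q.2 i else 0) p.1 q.1

theorem finrank_ker_bidiagonal_le {K : Type*} [Field K] {n m d : ℕ} (X : MatTuple K n m)
    (T : MatTuple K d m) (s : ℕ → MatTuple K d m) (k : ℕ) :
    Module.finrank K (LinearMap.ker (blowupLin _ _ X (bidiagonal T s k))) ≤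
      Module.finrank K
        (chainKer (blowupLin (Fin d) (Fin d) X T) (blowupLin (Fin d) (Fin d) X) s k) := by
  classical
  let c : Fin (k + 1) → (Fin n × (Fin d × Fin (k + 1)) → K) →ₗ[K] (Fin n × Fin d → K) :=
    fun j => LinearMap.funLeft K K fun p => (p.1, (p.2, j))
  have hc : ∀ x j, c j ((blowup X (bidiagonal T s k)).mulVec x) =
      ∑ l, (if l = j then blowup X T else
        if (l : ℕ) + 1 = j then blowup X (s l) else 0).mulVec (c l x) := fun x j => by
    ext ⟨a, b⟩
    change (blowup X (bidiagonal T s k)).mulVec x (a, (b, j)) = _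
    simp only [Matrix.mulVec, dotProduct, Fintype.sum_prod_type, Finset.sum_apply]
    conv_rhs => rw [Finset.sum_comm]; enter [2, a]; rw [Finset.sum_comm]
    refine Finset.sum_congr rfl fun a' _ => Finset.sum_congr rfl fun b' _ =>
      Finset.sum_congr rfl fun l _ => ?_
    change _ = _ * x (a', (b', l))
    congr 1
    rw [blowup_apply]
    simp only [bidiagonal, Matrix.of_apply]
    split_ifs <;> simp [blowup_apply]
  have hmem : ∀ x : LinearMap.ker (blowupLin _ _ X (bidiagonal T s k)),
      (fun j => c j x) ∈
        chainKer (blowupLin (Fin d) (Fin d) X T) (blowupLin (Fin d) (Fin d) X) s k := fun x => by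
    have hx : ∀ j : Fin (k + 1), ∑ l : Fin (k + 1), (if l = j then blowup X T else
        if (l : ℕ) + 1 = j then blowup X (s l) else 0).mulVec (c l x) = 0 := fun j => by
      rw [← hc, show (blowup X (bidiagonal T s k)).mulVec x.1 = 0 from x.2, map_zero]
    refine ⟨?_, fun j => ?_⟩
    · rw [← hx 0, Finset.sum_eq_single 0]
      · simp [blowupLin_apply]
      · intro l _ hl
        simp [hl]
      · simp
    · rw [← hx j.succ, ← Finset.sum_subset (Finset.subset_univ {j.succ, j.castSucc}),
        Finset.sum_pair (Fin.castSucc_lt_succ).ne']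
      · simp [blowupLin_apply, (Fin.castSucc_lt_succ (i := j)).ne]
      · intro l _ hl
        simp only [Finset.mem_insert, Finset.mem_singleton, not_or] at hl
        have : ¬ ((l : ℕ) + 1 = j.succ) := fun h => hl.2 (Fin.ext (by simpa using h))
        rw [if_neg hl.1, if_neg this, Matrix.zero_mulVec]
  let f : LinearMap.ker (blowupLin _ _ X (bidiagonal T s k)) →ₗ[K]
      chainKer (blowupLin (Fin d) (Fin d) X T) (blowupLin (Fin d) (Fin d) X) s k :=
    ((LinearMap.pi c).domRestrict _).codRestrict _ hmem
  refine LinearMap.finrank_le_finrank_of_injective (f := f) fun x y hxy => ?_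
  refine Subtype.ext (funext fun p => ?_)
  exact congrFun (congrFun (congrArg Subtype.val hxy) p.2.2) (p.1, p.2.1)

/-- A tuple without shrunk subspace has an invertible blow-up. -/
theorem exists_blowup_rank_eq_of_not_hasShrunkSubspace {K : Type*} [Field K] [Infinite K]
    {n m : ℕ} (X : MatTuple K n m) (hX : ¬ HasShrunkSubspace X) :
    ∃ d, 0 < d ∧ ∃ T : MatTuple K d m, (blowup X T).rank = n * d := by
  classical
  -- The quotients of the maximal rank by the size, integers by regularity and at most `n`.
  let A : Set ℕ := {q | ∃ d, 0 < d ∧ ∃ T : MatTuple K d m, (blowup X T).rank = d * q ∧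
    ∀ T' : MatTuple K d m, (blowup X T').rank ≤ (blowup X T).rank}
  have hmax : ∀ d, 0 < d → ∃ T : MatTuple K d m, ∃ q ∈ A, (blowup X T).rank = d * q ∧
      ∀ T' : MatTuple K d m, (blowup X T').rank ≤ (blowup X T).rank := fun d hd => by
    obtain ⟨T, hT⟩ := exists_max_rank_blowup (ι := Fin d) (κ := Fin d) X
    obtain ⟨q, hq⟩ := dvd_rank_blowup_of_max hd X T hT
    exact ⟨T, q, ⟨d, hd, T, hq, hT⟩, hq, hT⟩
  have hA : ∀ q ∈ A, q ≤ n := by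
    rintro q ⟨d, hd, T, hT, -⟩
    have h1 := Matrix.rank_le_card_width (blowup X T)
    rw [hT, Fintype.card_prod, Fintype.card_fin, Fintype.card_fin, mul_comm n d] at h1
    exact Nat.le_of_mul_le_mul_left h1 hd
  obtain ⟨q, ⟨d, hd, T, hT, -⟩, hq⟩ := Set.exists_max_image A id
    ((Set.finite_le_nat n).subset hA) (by
      obtain ⟨_, q, hq, -⟩ := hmax 1 one_pos
      exact ⟨q, hq⟩)
  refine ⟨d, hd, T, ?_⟩
  by_contra hne
  have hker := finrank_ker_blowupLin X T
  rw [Fintype.card_fin] at hker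
  -- A bidiagonal tuple has size `d * (k + 1)`, so its rank is at most `d * (k + 1) * q` by the
  -- choice of `q`; its kernel is therefore at least `k + 1` times as large as that of `T`.
  obtain ⟨P, Q, hPQ, hlt⟩ := exists_shrunk_of_le_finrank_chainKer
    (blowupLin (Fin d) (Fin d) X T) (blowupLin (Fin d) (Fin d) X) (fun s k => by
      refine le_trans ?_ (finrank_ker_bidiagonal_le X T s k)
      have h1 := finrank_ker_blowupLin X (bidiagonal T s k)
      obtain ⟨T', q', hq', hT', hmax'⟩ := hmax (d * (k + 1)) (by positivity)
      have h2 := hmax' fun j => (bidiagonal T s k j).submatrix finProdFinEquiv.symm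
        finProdFinEquiv.symm
      rw [rank_blowup_reindex, hT'] at h2
      have h3 : d * (k + 1) * q' ≤ d * (k + 1) * q := Nat.mul_le_mul_left _ (hq q' hq')
      rw [Fintype.card_prod, Fintype.card_fin, Fintype.card_fin] at h1
      have h4 : (k + 1) * (d * q) + (k + 1) *
          Module.finrank K (LinearMap.ker (blowupLin (Fin d) (Fin d) X T)) =
          n * (d * (k + 1)) := by
        rw [← mul_add, ← hT, hker]; ring
      have h5 : d * (k + 1) * q = (k + 1) * (d * q) := by ring
      omega)
  exact hX (hasShrunkSubspace_of_blowup X P Q (fun S x hx => hPQ S x hx) (by omega))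

end LeftRight

namespace LeftRight

open scoped Kronecker

/-! ### Semi-invariants and the null cone -/

theorem linearIndependent_row_of_rank_eq_card {K α : Type*} [Field K] [Fintype α]
    (A : Matrix α α K) (h : A.rank = Fintype.card α) : LinearIndependent K A.row := by
  rw [linearIndependent_iff_card_eq_finrank_span, Set.finrank,
    ← Matrix.rank_eq_finrank_span_row, h]

theorem fT_ne_zero_iff {K : Type*} [Field K] {n m d : ℕ} (T : MatTuple K d m)
    (X : MatTuple K n m) : fT T X ≠ 0 ↔ (blowup X T).rank = n * d := by
  constructor
  · intro h
    exact (Matrix.rank_of_det_ne_zero h).trans (by simp)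
  · intro h
    have hli := linearIndependent_row_of_rank_eq_card (blowup X T) (by simpa using h)
    rw [Matrix.linearIndependent_rows_iff_isUnit, Matrix.isUnit_iff_isUnit_det,
      isUnit_iff_ne_zero] at hli
    exact hli

theorem fT_act {K : Type*} [Field K] {n m d : ℕ} (T : MatTuple K d m)
    (g : Matrix.SpecialLinearGroup (Fin n) K × Matrix.SpecialLinearGroup (Fin n) K)
    (X : MatTuple K n m) : fT T (act g X) = fT T X := by
  have h : ∑ i, act g X i ⊗ₖ T i =
      ((g.1 : Matrix (Fin n) (Fin n) K) ⊗ₖ (1 : Matrix (Fin d) (Fin d) K)) *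
        (∑ i, X i ⊗ₖ T i) *
        (((g.2⁻¹ : Matrix.SpecialLinearGroup (Fin n) K) : Matrix (Fin n) (Fin n) K) ⊗ₖ
          (1 : Matrix (Fin d) (Fin d) K)) := by
    rw [Finset.mul_sum, Finset.sum_mul]
    refine Finset.sum_congr rfl fun i _ => ?_
    rw [← Matrix.mul_kronecker_mul, ← Matrix.mul_kronecker_mul, one_mul, mul_one]
    rfl
  unfold fT
  rw [h, Matrix.det_mul, Matrix.det_mul, Matrix.det_kronecker, Matrix.det_kronecker,
    Matrix.SpecialLinearGroup.det_coe, Matrix.SpecialLinearGroup.det_coe]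
  simp

/-- The polynomial function `f_T`. -/
noncomputable def semiInvariant {K : Type*} [Field K] {n m d : ℕ} (T : MatTuple K d m) :
    CoordRing K n m :=
  Matrix.det (Matrix.of fun p q : Fin n × Fin d =>
    ∑ i, MvPolynomial.X (i, p.1, q.1) * MvPolynomial.C (T i p.2 q.2))

theorem evalAt_semiInvariant {K : Type*} [Field K] {n m d : ℕ} (T : MatTuple K d m)
    (X : MatTuple K n m) : evalAt X (semiInvariant T) = fT T X := by
  unfold semiInvariant fT
  rw [AlgHom.map_det]
  congr 1
  ext p q
  simp [evalAt, Matrix.sum_apply, Matrix.kroneckerMap_apply]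

theorem semiInvariant_mem {K : Type*} [Field K] {n m d : ℕ} (T : MatTuple K d m) :
    semiInvariant T ∈ invariantRing K n m := fun g X => by
  rw [evalAt_semiInvariant, evalAt_semiInvariant, fT_act]

theorem isHomogeneous_semiInvariant {K : Type*} [Field K] {n m d : ℕ} (T : MatTuple K d m) :
    (semiInvariant T : CoordRing K n m).IsHomogeneous (n * d) := by
  unfold semiInvariant
  rw [Matrix.det_apply]
  refine MvPolynomial.IsHomogeneous.sum _ _ _ fun σ _ => ?_
  have h : (∏ p, (Matrix.of fun p q : Fin n × Fin d =>
      ∑ i, MvPolynomial.X (i, p.1, q.1) * MvPolynomial.C (T i p.2 q.2)) (σ p) p :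
      CoordRing K n m).IsHomogeneous (∑ _p : Fin n × Fin d, 1) := by
    refine MvPolynomial.IsHomogeneous.prod _ _ _ fun p _ => ?_
    rw [Matrix.of_apply]
    refine MvPolynomial.IsHomogeneous.sum _ _ _ fun i _ => ?_
    exact (MvPolynomial.isHomogeneous_X K (i, (σ p).1, p.1)).mul
      (MvPolynomial.isHomogeneous_C _ (T i (σ p).2 p.2))
  simp only [Finset.sum_const, Finset.card_univ, Fintype.card_prod, Fintype.card_fin, smul_eq_mul,
    mul_one] at h
  rcases Int.units_eq_one_or (Equiv.Perm.sign σ) with hσ | hσ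
  · rw [hσ, one_smul]
    exact h
  · rw [hσ, Units.neg_smul, one_smul]
    exact (MvPolynomial.homogeneousSubmodule _ K _).neg_mem h

theorem exists_adapted_basis {K : Type*} [Field K] {n : ℕ} (U : Submodule K (Fin n → K)) :
    ∃ (b : Module.Basis (Fin n) K (Fin n → K)) (J : Finset (Fin n)),
      J.card = Module.finrank K U ∧ (∀ j ∈ J, b j ∈ U) ∧ ∀ x ∈ U, ∀ j ∉ J, b.repr x j = 0 := by
  classical
  obtain ⟨C, hC⟩ := U.exists_isCompl
  let b₀ := ((Module.finBasis K U).prod (Module.finBasis K C)).map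
    (Submodule.prodEquivOfIsCompl U C hC)
  have hcard : Fintype.card (Fin (Module.finrank K U) ⊕ Fin (Module.finrank K C)) = n := by
    rw [← Module.finrank_eq_card_basis b₀, Module.finrank_fin_fun]
  let e := Fintype.equivFinOfCardEq hcard
  refine ⟨b₀.reindex e, Finset.univ.map (Function.Embedding.inl.trans e.toEmbedding), by simp,
    fun j hj => ?_, fun x hx j hj => ?_⟩
  · obtain ⟨i, -, rfl⟩ := Finset.mem_map.1 hj
    simp [b₀]
  · rw [Module.Basis.repr_reindex_apply]
    rcases h : e.symm j with i | i
    · refine absurd (Finset.mem_map.2 ⟨i, Finset.mem_univ i, ?_⟩) hj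
      simp [← h]
    · have := Submodule.prodEquivOfIsCompl_symm_apply_left U C hC ⟨x, hx⟩
      simp only at this
      simp [b₀, this]

theorem prod_ite_mem_eq_one {K : Type*} [Field K] {n : ℕ} (J : Finset (Fin n)) (x y : K)
    (h : x ^ J.card * y ^ (n - J.card) = 1) : ∏ i, (if i ∈ J then x else y) = 1 := by
  classical
  rw [Finset.prod_ite, Finset.prod_const, Finset.prod_const, Finset.filter_mem_eq_inter,
    Finset.univ_inter, Finset.filter_not, Finset.filter_mem_eq_inter, Finset.univ_inter,
    Finset.card_sdiff_of_subset (Finset.subset_univ J), Finset.card_univ, Fintype.card_fin, h]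

/-- The conjugate of a diagonal matrix of determinant one. -/
noncomputable def conjDiagonal {K : Type*} [Field K] {n : ℕ} (S : Matrix (Fin n) (Fin n) K)
    (hS : IsUnit S.det) (w : Fin n → K) (hw : ∏ i, w i = 1) :
    Matrix.SpecialLinearGroup (Fin n) K :=
  ⟨S * Matrix.diagonal w * S⁻¹, by
    rw [Matrix.det_mul_right_comm, Matrix.mul_nonsing_inv S hS, one_mul, Matrix.det_diagonal, hw]⟩

theorem evalAt_zero_of_isHomogeneous {K : Type*} [Field K] {n m e : ℕ} (he : 1 ≤ e)
    (f : CoordRing K n m) (hf : f.IsHomogeneous e) : evalAt (0 : MatTuple K n m) f = 0 := by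
  have h1 : evalAt (0 : MatTuple K n m) f = MvPolynomial.constantCoeff f := by
    exact MvPolynomial.aeval_zero (S₁ := K) f
  rw [h1, MvPolynomial.constantCoeff_eq]
  exact hf.coeff_eq_zero (by simp; omega)

/-- The easy direction of the Hilbert–Mumford criterion. In bases adapted to `U` and `W` the
matrices have a zero block so large that diagonal matrices of determinant one scale all other
entries by positive powers of `t`. -/
theorem mem_nullCone_of_hasShrunkSubspace {K : Type*} [Field K] [Infinite K] {n m : ℕ}
    (X : MatTuple K n m) (hX : HasShrunkSubspace X) : X ∈ nullCone K n m := by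
  classical
  obtain ⟨U, W, hUW, hlt⟩ := hX
  obtain ⟨bW, J, hJ, -, hJW⟩ := exists_adapted_basis W
  obtain ⟨bU, I, hI, hIU, -⟩ := exists_adapted_basis U
  let S : Matrix (Fin n) (Fin n) K := (Pi.basisFun K (Fin n)).toMatrix bW
  let R : Matrix (Fin n) (Fin n) K := (Pi.basisFun K (Fin n)).toMatrix bU
  have hSinv : bW.toMatrix (Pi.basisFun K (Fin n)) * S = 1 := bW.toMatrix_mul_toMatrix_flip _
  have hRinv : bU.toMatrix (Pi.basisFun K (Fin n)) * R = 1 := bU.toMatrix_mul_toMatrix_flip _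
  have hS : IsUnit S.det := Matrix.isUnit_det_of_left_inverse hSinv
  have hR : IsUnit R.det := Matrix.isUnit_det_of_left_inverse hRinv
  let Y : MatTuple K n m := fun i => S⁻¹ * X i * R
  have hY : ∀ i, ∀ a ∉ J, ∀ b ∈ I, Y i a b = 0 := fun i a ha b hb => by
    have h1 := hJW _ (hUW i _ (hIU b hb)) a ha
    have hcol : (fun k => (X i * R) k b) = (X i).mulVec (bU b) := by
      ext k
      simp [R, Matrix.mul_apply, Matrix.mulVec, dotProduct, Module.Basis.toMatrix_apply]
    have h2 : Y i a b = (S⁻¹.mulVec (fun k => (X i * R) k b)) a := by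
      simp only [Y, Matrix.mul_assoc]
      rfl
    have h3 := Module.Basis.toMatrix_mulVec_repr (Pi.basisFun K (Fin n)) bW ((X i).mulVec (bU b))
    rw [h2, hcol, Matrix.inv_eq_left_inv hSinv, ← h1, ← h3]
    rfl
  have hIn : I.card ≤ n := by simpa using I.card_le_univ
  have hJI : J.card < I.card := by omega
  -- The sums of the exponents of `α` and `β` below. On the block `a ∉ J`, `b ∈ I` the true sum is
  -- negative, but `Y` vanishes there and any positive value serves.
  let N : Fin n → Fin n → ℕ := fun a b =>
    if a ∈ J ∧ b ∉ I then n - J.card + I.card else I.card - J.card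
  have hN : ∀ a b, N a b ≠ 0 := fun a b => by
    simp only [N]
    split_ifs <;> omega
  intro e he f hf hfe
  let Z : Fin m → Matrix (Fin n) (Fin n) (Polynomial K) := fun i =>
    S.map Polynomial.C * (Matrix.of fun a b => Polynomial.C (Y i a b) * Polynomial.X ^ N a b) *
      R⁻¹.map Polynomial.C
  let Zt : K → MatTuple K n m := fun t i => S * (Matrix.of fun a b => Y i a b * t ^ N a b) * R⁻¹
  let p : Polynomial K := MvPolynomial.aeval (fun q => Z q.1 q.2.1 q.2.2) f
  have hp : ∀ t, p.eval t = evalAt (Zt t) f := fun t => by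
    simp only [p, evalAt]
    rw [← Polynomial.coe_aeval_eq_eval, MvPolynomial.comp_aeval_apply]
    congr 2
    funext q
    simp [Z, Zt, Matrix.mul_apply, Polynomial.eval_finsetSum]
  have hact : ∀ t, t ≠ 0 → ∃ g, act g X = Zt t := fun t ht => by
    let α : Fin n → K := fun a => if a ∈ J then t ^ (n - J.card) else (t ^ J.card)⁻¹
    let β : Fin n → K := fun b => if b ∈ I then (t ^ (n - I.card))⁻¹ else t ^ I.card
    have hα : ∏ a, α a = 1 := prod_ite_mem_eq_one J _ _ (by
      rw [inv_pow, ← pow_mul, ← pow_mul, mul_comm, mul_comm J.card]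
      exact inv_mul_cancel₀ (pow_ne_zero _ ht))
    have hβ : ∏ b, β b = 1 := prod_ite_mem_eq_one I _ _ (by
      rw [inv_pow, ← pow_mul, ← pow_mul, mul_comm I.card]
      exact inv_mul_cancel₀ (pow_ne_zero _ ht))
    refine ⟨(conjDiagonal S hS α hα, (conjDiagonal R hR β hβ)⁻¹), funext fun i => ?_⟩
    have h1 : ∀ a b, α a * Y i a b * β b = Y i a b * t ^ N a b := fun a b => by
      by_cases ha : a ∈ J <;> by_cases hb : b ∈ I
      · simp only [α, β, N, ha, hb, if_true, not_true, and_false, if_false]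
        have : t ^ (n - J.card) = t ^ (I.card - J.card) * t ^ (n - I.card) := by
          rw [← pow_add]; congr 1; omega
        rw [this]
        field_simp
      · simp only [α, β, N, ha, hb, if_true, not_false_eq_true, and_true, if_false]
        rw [pow_add]
        ring
      · rw [hY i a ha b hb]
        simp
      · simp only [α, β, N, ha, hb, false_and, if_false]
        have : t ^ I.card = t ^ (I.card - J.card) * t ^ J.card := by
          rw [← pow_add]; congr 1; omega
        rw [this]
        field_simp
    have h2 : Matrix.diagonal α * Y i * Matrix.diagonal β =
        Matrix.of fun a b => Y i a b * t ^ N a b := by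
      ext a b
      rw [Matrix.mul_diagonal, Matrix.diagonal_mul, h1, Matrix.of_apply]
    simp only [act, inv_inv]
    change S * Matrix.diagonal α * S⁻¹ * X i * (R * Matrix.diagonal β * R⁻¹) = S * _ * R⁻¹
    rw [← h2]
    simp only [Y, mul_assoc]
  -- Agreement at all `t ≠ 0` is enough since `K` is infinite; the value at `t = 0` then becomes
  -- available.
  have hpX : p = Polynomial.C (evalAt X f) := by
    refine Polynomial.eq_of_infinite_eval_eq _ _
      ((Set.finite_singleton (0 : K)).infinite_compl.mono fun t ht => ?_)
    obtain ⟨g, hg⟩ := hact t ht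
    change p.eval t = _
    rw [hp, ← hg, hf, Polynomial.eval_C]
  have h0 := hp 0
  have hZ0 : Zt 0 = 0 := funext fun i => by
    have : (Matrix.of fun a b => Y i a b * (0 : K) ^ N a b) = 0 := by
      ext a b
      simp [hN]
    simp only [Zt, this]
    simp
  rw [hZ0, evalAt_zero_of_isHomogeneous he f hfe, hpX, Polynomial.eval_C] at h0
  exact h0

end LeftRight

namespace LeftRight

open scoped Kronecker

/-! ### Spaces of matrices of rank at most one -/

/-- Hypothesis `hA` says that the maps have rank at most one. If `f k` and `g k` are independent and
`g x = 0`, then `f x = (f + g) x` lies on the two distinct lines of `f k` and `(f + g) k`, so it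
vanishes. The remaining `f` are reached by adding `h`. -/
theorem rank_le_one_dichotomy {K V W : Type*} [Field K] [AddCommGroup V] [Module K V]
    [AddCommGroup W] [Module K W] (A : Submodule K (V →ₗ[K] W))
    (hA : ∀ f ∈ A, ∀ k, f k ≠ 0 → ∀ x, f x ∈ Submodule.span K {f k}) :
    (∃ a : W, ∀ f ∈ A, ∀ x, f x ∈ Submodule.span K {a}) ∨
      ∃ g ∈ A, ∀ f ∈ A, LinearMap.ker g ≤ LinearMap.ker f := by
  by_cases hz : ∀ f ∈ A, ∀ x, f x = 0
  · exact Or.inl ⟨0, fun f hf x => by rw [hz f hf x]; exact Submodule.zero_mem _⟩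
  push Not at hz
  obtain ⟨g, hg, k, hk⟩ := hz
  by_cases hall : ∀ f ∈ A, f k ∈ Submodule.span K {g k}
  · refine Or.inl ⟨g k, fun f hf x => ?_⟩
    by_cases hfk : f k = 0
    · have h1 := hA (f + g) (A.add_mem hf hg) k (by simpa [hfk] using hk) x
      simp only [LinearMap.add_apply, hfk, zero_add] at h1
      exact (Submodule.add_mem_iff_left _ (hA g hg k hk x)).1 h1
    · exact (Submodule.span_singleton_le_iff_mem _ _).2 (hall f hf) (hA f hf k hfk x)
  push Not at hall
  obtain ⟨h, hh, hhk⟩ := hall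
  have key : ∀ f ∈ A, f k ∉ Submodule.span K {g k} → LinearMap.ker g ≤ LinearMap.ker f := by
    intro f hf hfk x hx
    rw [LinearMap.mem_ker] at hx ⊢
    have hf0 : f k ≠ 0 := fun h0 => hfk (h0 ▸ Submodule.zero_mem _)
    have hfg0 : (f + g) k ≠ 0 := fun h0 => hfk (by
      rw [LinearMap.add_apply] at h0
      rw [eq_neg_of_add_eq_zero_left h0]
      exact Submodule.neg_mem _ (Submodule.mem_span_singleton_self _))
    obtain ⟨μ, hμ⟩ := Submodule.mem_span_singleton.1 (hA f hf k hf0 x)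
    obtain ⟨ν, hν⟩ := Submodule.mem_span_singleton.1 (hA (f + g) (A.add_mem hf hg) k hfg0 x)
    rw [LinearMap.add_apply, LinearMap.add_apply, hx, add_zero, ← hμ, smul_add] at hν
    have h1 : (μ - ν) • f k = ν • g k := by
      rw [sub_smul, ← hν]
      abel
    by_cases hμν : μ - ν = 0
    · rw [hμν, zero_smul] at h1
      have h2 : ν = 0 := (smul_eq_zero.1 h1.symm).resolve_right hk
      rw [← hμ, sub_eq_zero.1 hμν, h2, zero_smul]
    · exact absurd ((Submodule.smul_mem_iff _ hμν).1
        (h1 ▸ Submodule.smul_mem _ _ (Submodule.mem_span_singleton_self _))) hfk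
  refine Or.inr ⟨g, hg, fun f hf => ?_⟩
  by_cases hfk : f k ∈ Submodule.span K {g k}
  · intro x hx
    have h1 := key (f + h) (A.add_mem hf hh) (fun h' => hhk
      ((Submodule.add_mem_iff_right _ hfk).1 h')) hx
    have h2 := key h hh hhk hx
    rw [LinearMap.mem_ker] at h1 h2 ⊢
    rwa [LinearMap.add_apply, h2, add_zero] at h1
  · exact key f hf hfk

/-- The linear combinations of the matrices of a tuple. -/
def pencil {K : Type*} [Field K] {n m : ℕ} (X : MatTuple K n m) :
    (Fin m → K) →ₗ[K] (Fin n → K) →ₗ[K] (Fin n → K) :=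
  Fintype.linearCombination K fun i => (X i).mulVecLin

theorem pencil_apply {K : Type*} [Field K] {n m : ℕ} (X : MatTuple K n m) (c : Fin m → K)
    (x : Fin n → K) : pencil X c x = ∑ i, c i • (X i).mulVec x := by
  simp [pencil, Fintype.linearCombination_apply, LinearMap.sum_apply]

theorem pencil_single {K : Type*} [Field K] {n m : ℕ} (X : MatTuple K n m) (i : Fin m) :
    pencil X (Pi.single i 1) = (X i).mulVecLin := by
  simp [pencil]

/-- Otherwise all combinations have rank at most one. A common image line makes the whole space
shrunk, as `n ≥ 2`; a common kernel of dimension at least `n - 1` is shrunk to `0`. -/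
theorem exists_finrank_ker_pencil_add_two_le {K : Type*} [Field K] {n m : ℕ} (hn : 2 ≤ n)
    (X : MatTuple K n m) (hX : ¬ HasShrunkSubspace X) :
    ∃ c, Module.finrank K (LinearMap.ker (pencil X c)) + 2 ≤ n := by
  by_contra! hc
  have hrank : ∀ c, Module.finrank K (LinearMap.range (pencil X c)) ≤ 1 := fun c => by
    have h1 := LinearMap.finrank_range_add_finrank_ker (pencil X c)
    rw [Module.finrank_fin_fun] at h1
    have := hc c
    omega
  have hmem : ∀ i, (X i).mulVecLin ∈ LinearMap.range (pencil X) :=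
    fun i => ⟨_, pencil_single X i⟩
  rcases rank_le_one_dichotomy (LinearMap.range (pencil X)) (by
    rintro _ ⟨c, rfl⟩ k hk x
    have hle : Submodule.span K {pencil X c k} ≤ LinearMap.range (pencil X c) :=
      (Submodule.span_singleton_le_iff_mem _ _).2 ⟨k, rfl⟩
    rw [Submodule.eq_of_le_of_finrank_le hle (by rw [finrank_span_singleton hk]; exact hrank c)]
    exact ⟨x, rfl⟩) with ⟨a, ha⟩ | ⟨_, ⟨c, rfl⟩, hg⟩
  · refine hX ⟨⊤, Submodule.span K {a}, fun i u _ => ha _ (hmem i) u, ?_⟩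
    rw [finrank_top, Module.finrank_fin_fun]
    have := finrank_span_le_card (R := K) ({a} : Set (Fin n → K))
    simp only [Set.toFinset_singleton, Finset.card_singleton] at this
    omega
  · refine hX ⟨LinearMap.ker (pencil X c), ⊥, fun i u hu => ?_, ?_⟩
    · exact (Submodule.mem_bot K).2 (hg _ (hmem i) hu)
    · rw [finrank_bot]
      have := hc c
      omega

/-- Starting from rank two, each further combination removes a dimension: a nonzero vector killed by
all `X i` would span a shrunk subspace. The start at two is what makes `n - 1` combinations suffice
instead of `n`. -/
theorem exists_common_kernel_le {K : Type*} [Field K] {n m : ℕ} (hn : 2 ≤ n)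
    (X : MatTuple K n m) (hX : ¬ HasShrunkSubspace X) (k : ℕ) :
    ∃ c : Fin (k + 1) → Fin m → K,
      Module.finrank K (⨅ a, LinearMap.ker (pencil X (c a)) : Submodule K (Fin n → K)) ≤
        n - 2 - k := by
  induction k with
  | zero =>
    obtain ⟨c, hc⟩ := exists_finrank_ker_pencil_add_two_le hn X hX
    refine ⟨fun _ => c, ?_⟩
    rw [iInf_const]
    omega
  | succ k ih =>
    obtain ⟨c, hc⟩ := ih
    by_cases hbot : (⨅ a, LinearMap.ker (pencil X (c a)) : Submodule K (Fin n → K)) = ⊥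
    · refine ⟨Fin.snoc c 0, ?_⟩
      have : (⨅ a, LinearMap.ker (pencil X ((Fin.snoc c 0 : Fin (k + 1 + 1) → Fin m → K) a)) :
          Submodule K (Fin n → K)) = ⊥ := by
        rw [eq_bot_iff, ← hbot]
        refine le_iInf fun a => (iInf_le _ a.castSucc).trans_eq ?_
        rw [Fin.snoc_castSucc]
      rw [this, finrank_bot]
      exact Nat.zero_le _
    · obtain ⟨v, hv, hv0⟩ := Submodule.exists_mem_ne_zero_of_ne_bot hbot
      obtain ⟨i, hi⟩ : ∃ i, (X i).mulVec v ≠ 0 := by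
        by_contra! h
        refine hX ⟨Submodule.span K {v}, ⊥, fun i u hu => ?_, ?_⟩
        · obtain ⟨t, rfl⟩ := Submodule.mem_span_singleton.1 hu
          rw [Matrix.mulVec_smul, h, smul_zero]
          exact Submodule.zero_mem _
        · rw [finrank_bot, finrank_span_singleton hv0]
          exact one_pos
      refine ⟨Fin.snoc c (Pi.single i 1), ?_⟩
      have hlt : (⨅ a, LinearMap.ker
          (pencil X ((Fin.snoc c (Pi.single i 1) : Fin (k + 1 + 1) → Fin m → K) a)) :
          Submodule K (Fin n → K)) < ⨅ a, LinearMap.ker (pencil X (c a)) := by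
        refine lt_of_le_of_ne (le_iInf fun a => (iInf_le _ a.castSucc).trans_eq ?_) fun h => ?_
        · rw [Fin.snoc_castSucc]
        · rw [← h] at hv
          have := (Submodule.mem_iInf _).1 hv (Fin.last (k + 1))
          rw [Fin.snoc_last, pencil_single] at this
          exact hi this
      have := Submodule.finrank_lt_finrank_of_lt hlt
      omega

theorem exists_blowup_column_rank_eq {K : Type*} [Field K] {n m e : ℕ} (hn : 2 ≤ n)
    (he : n - 1 ≤ e) (X : MatTuple K n m) (hX : ¬ HasShrunkSubspace X) :
    ∃ T : Fin m → Matrix (Fin e) (Fin 1) K, n ≤ (blowup X T).rank := by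
  obtain ⟨k, rfl⟩ : ∃ k, e = k + 1 := ⟨e - 1, by omega⟩
  obtain ⟨c, hc⟩ := exists_common_kernel_le hn X hX k
  refine ⟨fun i => Matrix.of fun a _ => c a i, ?_⟩
  have h0 : (⨅ a, LinearMap.ker (pencil X (c a)) : Submodule K (Fin n → K)) = ⊥ := by
    rw [← Submodule.finrank_eq_zero (R := K)]
    omega
  have h1 := finrank_ker_blowupLin X fun i => (Matrix.of fun a _ => c a i :
    Matrix (Fin (k + 1)) (Fin 1) K)
  have h2 : LinearMap.ker (blowupLin _ _ X fun i => (Matrix.of fun a _ => c a i :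
      Matrix (Fin (k + 1)) (Fin 1) K)) = ⊥ := by
    rw [LinearMap.ker_eq_bot']
    intro x hx
    have h3 : component 0 x ∈ (⨅ a, LinearMap.ker (pencil X (c a)) :
        Submodule K (Fin n → K)) := by
      refine (Submodule.mem_iInf _).2 fun a => ?_
      have h4 := component_blowup X (fun i => (Matrix.of fun a _ => c a i :
        Matrix (Fin (k + 1)) (Fin 1) K)) x a
      rw [← blowupLin_apply, hx, map_zero] at h4
      rw [LinearMap.mem_ker, pencil_apply, h4]
      simp
    rw [h0, Submodule.mem_bot] at h3
    ext ⟨a, j⟩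
    rw [Subsingleton.elim j 0]
    exact congrFun h3 a
  rw [h2, finrank_bot] at h1
  simp only [Fintype.card_fin] at h1
  omega

end LeftRight

namespace LeftRight

open scoped Kronecker

/-! ### Decreasing the size of an invertible blow-up -/

/-- The map from `V` to the product of the quotients by `H j.succ` is onto, because `C j.succ`
covers its own factor and dies in the others; `C 0` lies in the kernel. -/
theorem finrank_add_sum_finrank_quotient_le {K V : Type*} [Field K] [AddCommGroup V] [Module K V]
    [FiniteDimensional K V] {e : ℕ} (C H : Fin (e + 1) → Submodule K V) (hC : ⨆ b, C b = ⊤)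
    (hCH : ∀ b c, c ≠ b → C c ≤ H b) :
    Module.finrank K (C 0) + ∑ j : Fin e, Module.finrank K (V ⧸ H j.succ) ≤
      Module.finrank K V := by
  classical
  let φ : V →ₗ[K] (∀ j : Fin e, V ⧸ H j.succ) := LinearMap.pi fun j => (H j.succ).mkQ
  have hsurj : LinearMap.range φ = ⊤ := by
    rw [eq_top_iff]
    intro x _
    rw [← Finset.univ_sum_single x]
    refine Submodule.sum_mem _ fun j _ => ?_
    obtain ⟨v, hv⟩ := (H j.succ).mkQ_surjective (x j)
    have hle : ⨆ b, C b ≤ C j.succ ⊔ H j.succ := iSup_le fun b => by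
      by_cases h : b = j.succ
      · exact h ▸ le_sup_left
      · exact (hCH _ _ h).trans le_sup_right
    obtain ⟨c, hc, w, hw, rfl⟩ := Submodule.mem_sup.1 (hle (hC ▸ Submodule.mem_top : v ∈ _))
    refine ⟨c, funext fun i => ?_⟩
    change (H i.succ).mkQ c = _
    by_cases hij : i = j
    · subst hij
      have hw0 : (H i.succ).mkQ w = 0 := (Submodule.Quotient.mk_eq_zero _).2 hw
      rw [Pi.single_eq_same, ← hv, map_add, hw0, add_zero]
    · rw [Pi.single_eq_of_ne hij]
      exact (Submodule.Quotient.mk_eq_zero _).2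
        (hCH _ _ (fun h => hij (Fin.succ_injective _ h.symm)) hc)
  have hker : C 0 ≤ LinearMap.ker φ := fun x hx => by
    rw [LinearMap.mem_ker]
    funext j
    exact (Submodule.Quotient.mk_eq_zero _).2 (hCH _ _ (Fin.succ_ne_zero j).symm hx)
  have h1 := LinearMap.finrank_range_add_finrank_ker φ
  rw [hsurj, finrank_top, Module.finrank_pi_fintype] at h1
  have h2 := Submodule.finrank_mono hker
  omega

theorem exists_blowup_rank_eq_of_succ {K : Type*} [Field K] [Infinite K] {n m e : ℕ} (hn : 2 ≤ n)
    (he : n - 1 ≤ e) (X : MatTuple K n m) (hX : ¬ HasShrunkSubspace X)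
    (hfull : ∃ T : MatTuple K (e + 1) m, (blowup X T).rank = n * (e + 1)) :
    ∃ T : MatTuple K e m, (blowup X T).rank = n * e := by
  classical
  obtain ⟨T₁, hT₁⟩ := hfull
  obtain ⟨S, hS⟩ := exists_blowup_column_rank_eq hn he X hX
  obtain ⟨p₁, hp₁, hle₁⟩ := exists_polynomial_rank_le
    (genericBlowup (Fin (e + 1)) (Fin (e + 1)) X) (fun q => T₁ q.1 q.2.1 q.2.2)
  -- The witness repeats the column `S` in every column and is zero in the last row. Only the first
  -- `e` rows of column `0` enter the submatrix.
  obtain ⟨p₂, hp₂, hle₂⟩ := exists_polynomial_rank_le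
    ((genericBlowup (Fin (e + 1)) (Fin (e + 1)) X).submatrix (Prod.map id Fin.castSucc)
      (Prod.map id fun _ : Fin 1 => 0))
    (fun q => if h : q.2.1 = Fin.last e then 0 else S q.1 (q.2.1.castPred h) 0)
  obtain ⟨y, -, hy⟩ := exists_eval_ne_zero_of_infinite (S := (Set.univ : Set K))
    Set.infinite_univ (p := p₁ * p₂) (mul_ne_zero (by rintro rfl; simp at hp₁)
      (by rintro rfl; simp at hp₂))
  rw [map_mul] at hy
  replace hle₁ := hle₁ y (left_ne_zero_of_mul hy)
  replace hle₂ := hle₂ y (right_ne_zero_of_mul hy)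
  simp only [← Matrix.submatrix_map, genericBlowup_map_eval, ← blowup_submatrix] at hle₁ hle₂
  let T : MatTuple K (e + 1) m := fun j => Matrix.of fun i k => y (j, i, k)
  replace hle₁ : n * (e + 1) ≤ (blowup X T).rank := hT₁ ▸ hle₁
  replace hle₂ : n ≤ (blowup X fun j => (T j).submatrix Fin.castSucc fun _ : Fin 1 => 0).rank := by
    refine hS.trans (le_of_eq_of_le ?_ hle₂)
    congr 2
    funext j
    ext i k
    rw [Subsingleton.elim k 0]
    simp [Fin.castSucc_ne_last]
  let N := blowup X fun j => (T j).submatrix Fin.castSucc id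
  have hrow : LinearIndependent K (blowup X T).row :=
    linearIndependent_row_of_rank_eq_card _ (le_antisymm (Matrix.rank_le_card_width _)
      (by simpa using hle₁))
  have hN : LinearMap.range N.mulVecLin = ⊤ := by
    apply Submodule.eq_top_of_finrank_eq
    have h1 : LinearIndependent K N.row := by
      simp only [N, blowup_submatrix]
      exact hrow.comp (Prod.map id Fin.castSucc)
        (Function.injective_id.prodMap (Fin.castSucc_injective e))
    change N.rank = _
    rw [h1.rank_matrix]
    simp
  let C : Fin (e + 1) → Submodule K (Fin n × Fin e → K) := fun b =>
    LinearMap.range (blowup X fun j => (T j).submatrix Fin.castSucc fun _ : Fin 1 => b).mulVecLin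
  let H : Fin (e + 1) → Submodule K (Fin n × Fin e → K) := fun b =>
    LinearMap.range (blowup X fun j => (T j).submatrix Fin.castSucc b.succAbove).mulVecLin
  have hC : ⨆ b, C b = ⊤ := by
    rw [eq_top_iff, ← hN, Matrix.range_mulVecLin, Submodule.span_le]
    rintro _ ⟨⟨a, b⟩, rfl⟩
    refine Submodule.mem_iSup_of_mem b ?_
    simp only [C, Matrix.range_mulVecLin]
    refine Submodule.subset_span ⟨(a, 0), ?_⟩
    ext q
    simp [N, blowup_apply]
  have hCH : ∀ b c, c ≠ b → C c ≤ H b := fun b c hcb => by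
    obtain ⟨c, rfl⟩ := Fin.exists_succAbove_eq hcb
    simp only [C, H, Matrix.range_mulVecLin]
    refine Submodule.span_mono ?_
    rintro _ ⟨⟨a, i⟩, rfl⟩
    refine ⟨(a, c), ?_⟩
    ext q
    simp [blowup_apply]
  have hsum := finrank_add_sum_finrank_quotient_le C H hC hCH
  have hV : Module.finrank K (Fin n × Fin e → K) = n * e := by simp
  rw [hV] at hsum
  replace hle₂ : n ≤ Module.finrank K (C 0) := hle₂
  have he0 : 0 < e := by omega
  -- If every deletion left rank at most `(n - 1) * e`, each quotient would have dimension at least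
  -- `e`, so `n + e * e ≤ n * e`. This is impossible for `n ≤ e + 1`, and the summand `n` from
  -- column `0` is needed when `e = n - 1`.
  obtain ⟨j, hj⟩ : ∃ j : Fin e, (n - 1) * e < Module.finrank K (H j.succ) := by
    by_contra! h
    have h1 : ∑ j : Fin e, e ≤ ∑ j : Fin e, Module.finrank K ((Fin n × Fin e → K) ⧸ H j.succ) := by
      refine Finset.sum_le_sum fun j _ => ?_
      have h2 := (H j.succ).finrank_quotient_add_finrank
      have h3 := h j
      rw [hV] at h2
      rw [Nat.sub_mul, one_mul] at h3
      have : e ≤ n * e := Nat.le_mul_of_pos_left e (by omega)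
      omega
    rw [Finset.sum_const, Finset.card_univ, Fintype.card_fin, smul_eq_mul] at h1
    have h4 : n + e * e ≤ n * e := by omega
    have h5 : n ≤ e + 1 := by omega
    nlinarith
  obtain ⟨T', hT'⟩ := exists_max_rank_blowup (ι := Fin e) (κ := Fin e) X
  refine ⟨T', ?_⟩
  obtain ⟨q, hq⟩ := dvd_rank_blowup_of_max he0 X T' hT'
  have h1 : (n - 1) * e < e * q := by
    rw [← hq]
    exact hj.trans_le (hT' _)
  have h2 : e * q ≤ n * e := by
    rw [← hq]
    exact (Matrix.rank_le_card_width _).trans_eq (by simp)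
  have h3 : n - 1 < q := by
    rw [mul_comm] at h1
    exact lt_of_mul_lt_mul_left h1 (Nat.zero_le e)
  have h4 : q ≤ n := by
    rw [mul_comm n] at h2
    exact le_of_mul_le_mul_left h2 he0
  rw [hq, show q = n by omega, mul_comm]

/-- Block diagonal repetition of `T`, as a bidiagonal tuple with zeros below the diagonal. -/
theorem exists_blowup_rank_eq_mul {K : Type*} [Field K] {n m d : ℕ} (X : MatTuple K n m)
    (T : MatTuple K d m) (hT : (blowup X T).rank = n * d) (k : ℕ) :
    ∃ T' : MatTuple K (d * (k + 1)) m, (blowup X T').rank = n * (d * (k + 1)) := by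
  refine ⟨fun j => (bidiagonal T 0 k j).submatrix finProdFinEquiv.symm finProdFinEquiv.symm, ?_⟩
  rw [rank_blowup_reindex]
  have h1 := finrank_ker_blowupLin X T
  have h2 := (finrank_ker_bidiagonal_le X T 0 k).trans (finrank_chainKer_le _ _ _ _)
  have h3 := finrank_ker_blowupLin X (bidiagonal T 0 k)
  rw [Fintype.card_fin, hT] at h1
  rw [Nat.add_eq_left.1 h1, mul_zero] at h2
  rw [Nat.le_zero.1 h2, add_zero] at h3
  simpa using h3

theorem exists_blowup_rank_eq {K : Type*} [Field K] [Infinite K] {n m : ℕ} (hn : 2 ≤ n)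
    (X : MatTuple K n m) (hX : ¬ HasShrunkSubspace X) (d : ℕ) (hd : n - 1 ≤ d) :
    ∃ T : MatTuple K d m, (blowup X T).rank = n * d := by
  obtain ⟨d₀, hd₀, T, hT⟩ := exists_blowup_rank_eq_of_not_hasShrunkSubspace X hX
  -- The size `d₀` may be below `d`, so it is first raised to a multiple that is at least `d` and
  -- then lowered one by one.
  have hle : d ≤ d₀ * (d + 1) := (Nat.le_succ d).trans (Nat.le_mul_of_pos_left _ hd₀)
  exact Nat.decreasingInduction' (P := fun e => ∃ T : MatTuple K e m, (blowup X T).rank = n * e)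
    (fun e _ he h => exists_blowup_rank_eq_of_succ hn (hd.trans he) X hX h) hle
    (exists_blowup_rank_eq_mul X T hT d)

end LeftRight

theorem theorem1p4 (K : Type*) [Field K] [Infinite K] (n m : ℕ) (hn : 2 ≤ n) :
    (∀ X : LeftRight.MatTuple K n m, X ∉ LeftRight.nullCone K n m →
      ∀ d : ℕ, n - 1 ≤ d → ∃ T : LeftRight.MatTuple K d m, LeftRight.fT T X ≠ 0) ∧
    (IsLeast (LeftRight.deltaSet K n m) (LeftRight.delta K n m) ∧
      LeftRight.delta K n m ≤ n - 1) ∧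
    (IsLeast (LeftRight.gammaSet K n m) (LeftRight.gamma K n m) ∧
      LeftRight.gamma K n m ≤ n * (n - 1)) := by
  have hmain : ∀ X : LeftRight.MatTuple K n m, X ∉ LeftRight.nullCone K n m →
      ∀ d : ℕ, n - 1 ≤ d → ∃ T : LeftRight.MatTuple K d m, LeftRight.fT T X ≠ 0 := by
    intro X hX d hd
    obtain ⟨T, hT⟩ := LeftRight.exists_blowup_rank_eq hn X
      (fun h => hX (LeftRight.mem_nullCone_of_hasShrunkSubspace X h)) d hd
    exact ⟨T, (LeftRight.fT_ne_zero_iff T X).2 hT⟩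
  have hδ : n - 1 ∈ LeftRight.deltaSet K n m := by
    refine ⟨by omega, fun X hX => ⟨n - 1, by omega, le_rfl, hmain X hX (n - 1) le_rfl⟩⟩
  have hγ : n * (n - 1) ∈ LeftRight.gammaSet K n m := by
    have hpos : 1 ≤ n * (n - 1) := Nat.mul_pos (by omega) (by omega)
    refine ⟨hpos, Set.Subset.antisymm (fun X hX => ?_) fun X hX e he _ => hX e he⟩
    by_contra hX'
    obtain ⟨T, hT⟩ := hmain X hX' (n - 1) le_rfl
    apply hT
    rw [← LeftRight.evalAt_semiInvariant]
    exact hX _ hpos le_rfl _ (LeftRight.semiInvariant_mem T)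
      (LeftRight.isHomogeneous_semiInvariant T)
  exact ⟨hmain, ⟨⟨Nat.sInf_mem ⟨_, hδ⟩, fun _ hk => Nat.sInf_le hk⟩, Nat.sInf_le hδ⟩,
    ⟨⟨Nat.sInf_mem ⟨_, hγ⟩, fun _ hk => Nat.sInf_le hk⟩, Nat.sInf_le hγ⟩⟩
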